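/- All graphs are finite and simple. A graph is three-connected if it has more than three vertices and remains connected after deleting any set of at most two vertices. Let $G$ be a 3-regular, three-connected, planar graph. Then there are an integer $n\ge 0$ and graphs $G=H_0,H_1,\dots,H_n\cong K_4$, each of which is simple, 3-regular, three-connected and planar, such that for every $i<n$ the graph $H_{i+1}$ is isomorphic to a graph obtained from $H_i$ by one of the following two operations. (1) $\Delta Y$ operation: for a triangular face $abc$ of a planar embedding of $H_i$, the edges $ab,bc,ca$ are deleted, a new vertex $y$ adjacent to $a,b,c$ is added, and the vertices $a,b,c$ (which now have valence two) are suppressed by contracting, for each of them, the edge to its neighbour outside the triangle. In other words, $a,b,c$ are replaced by the single vertex $y$, which is joined to the vertices outside the triangle that are adjacent to $a$, $b$ or $c$. (2) Contraction-elongation operation on an edge $v_1v_2$: let $u_1,u_2$ be the other two neighbours of $v_1$ and $u_3,u_4$ the other two neighbours of $v_2$, named so that in a planar embedding of $H_i$ the two faces along $v_1v_2$ have $u_1,v_1,v_2,u_3$ and $u_4,v_2,v_1,u_2$, respectively, as consecutive boundary vertices. The edge $v_1v_2$ is contracted and the resulting 4-valent vertex is elongated to a new edge $w_1w_2$ such that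 $w_1$ is joined to $u_1,u_3$ and $w_2$ is joined to $u_2,u_4$. -/

import Mathlib

universe u

namespace SimpleGraph

variable {V : Type u}

/-- A graph is cubic (3-regular) if every vertex has exactly three neighbours. -/
def IsCubic (G : SimpleGraph V) : Prop :=
  ∀ v : V, (G.neighborSet v).ncard = 3

/-- A (finite) graph is three-connected if it has more than three vertices and stays connected
after the deletion of any set of at most two vertices. -/
def IsThreeConnected (G : SimpleGraph V) : Prop :=
  3 < Nat.card V ∧
    ∀ S : Finset V, S.card < 3 → (G.induce {v : V | v ∉ S}).Connected

/-- A rotation system on a graph: a permutation `rot` of the darts (oriented edges) that cyclically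
permutes the darts leaving each vertex. It describes a cellular embedding of each component of the
graph into an oriented closed surface, `rot` being the cyclic order around the vertices. -/
structure RotationSystem (G : SimpleGraph V) where
  rot : Equiv.Perm G.Dart
  rot_fst : ∀ d : G.Dart, (rot d).fst = d.fst
  rot_cycle : ∀ d d' : G.Dart, d.fst = d'.fst → rot.SameCycle d d'

namespace RotationSystem

variable {G : SimpleGraph V}

/-- The face permutation: the dart `u → v` is followed, along the boundary of the face on a fixed
side of it, by the dart that leaves `v` and comes next after `v → u` in the rotation at `v`. -/
def faceNext (R : G.RotationSystem) : Equiv.Perm G.Dart :=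
  (Dart.symm_involutive (G := G)).toPerm.trans R.rot

/-- The boundary walks of the faces: the cycles of the face permutation. -/
def Face (R : G.RotationSystem) : Type u :=
  Quotient (Equiv.Perm.SameCycle.setoid R.faceNext)

/-- The rotation system of a finite graph is planar if each component is embedded in the sphere:
Euler's formula `#V - #E + #F = 2 #C` holds, where the faces are counted component by component
and an isolated vertex, which has no dart, lies on a face of its own. (Each component satisfies
`#V - #E + #F ≤ 2`, so that equality for the sums means equality for every component.) -/
def IsPlanar (R : G.RotationSystem) : Prop :=
  Nat.card V + (Nat.card R.Face + Nat.card {v : V // ∀ w, ¬ G.Adj v w}) =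
    Nat.card G.edgeSet + 2 * Nat.card G.ConnectedComponent

/-- The darts `u → v` and `v → w` are consecutive on the boundary of a face. -/
def Consecutive (R : G.RotationSystem) (u v w : V) : Prop :=
  ∃ (huv : G.Adj u v) (hvw : G.Adj v w), R.faceNext ⟨(u, v), huv⟩ = ⟨(v, w), hvw⟩

end RotationSystem

/-- A finite graph is planar if it has a planar (combinatorial) embedding. -/
def IsPlanar (G : SimpleGraph V) : Prop :=
  ∃ R : G.RotationSystem, R.IsPlanar

/-- The graph obtained from a cubic graph `G` with a triangle `a b c` by replacing the triangle by
a Y: the edges of the triangle are deleted, a new vertex `none` is joined to `a`, `b`, `c`, and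
then each of `a`, `b`, `c`, which now has valence two, is suppressed by contracting the edge to
its neighbour outside the triangle (multiple edges, if any, become simple). So the new vertex
replaces `a`, `b`, `c` and its neighbours are the remaining vertices adjacent to `a`, `b` or `c`. -/
def deltaY (G : SimpleGraph V) (a b c : V) :
    SimpleGraph (Option {v : V // v ≠ a ∧ v ≠ b ∧ v ≠ c}) where
  Adj
    | some x, some y => G.Adj x y
    | some x, none => G.Adj x a ∨ G.Adj x b ∨ G.Adj x c
    | none, some y => G.Adj y a ∨ G.Adj y b ∨ G.Adj y c
    | none, none => False
  symm := by
    constructor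
    rintro (_ | x) (_ | y) h
    · exact h
    · exact h
    · exact h
    · exact G.adj_symm h
  loopless := by
    constructor
    rintro (_ | x) h
    · exact h
    · exact G.irrefl h

/-- `G'` arises from the cubic planar graph `G` by a ΔY transformation: a triangular face `a b c`
of a planar embedding of `G` is replaced by a Y. -/
def IsDeltaY {W : Type u} (G : SimpleGraph V) (G' : SimpleGraph W) : Prop :=
  ∃ R : G.RotationSystem, R.IsPlanar ∧ ∃ a b c : V,
    R.Consecutive a b c ∧ R.Consecutive b c a ∧ R.Consecutive c a b ∧
    Nonempty (G' ≃g G.deltaY a b c)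

/-- Let `v₁ v₂` be an edge, let `u₁, u₂` be the other neighbours of `v₁` and `u₃, u₄` those of
`v₂`. Contract `v₁ v₂` to a vertex with neighbours `u₁, u₂, u₃, u₄` and elongate this vertex to a
new edge `w₁ w₂`, with `w₁` joined to `u₁, u₃` and `w₂` joined to `u₂, u₄`. Here `w₁, w₂` are
again called `v₁, v₂`, so that only the edges `v₁ u₂` and `v₂ u₃` change. -/
def contractElongate (G : SimpleGraph V) (v₁ v₂ u₂ u₃ : V) : SimpleGraph V :=
  G.deleteEdges {s(v₁, u₂), s(v₂, u₃)} ⊔ fromEdgeSet {s(v₁, u₃), s(v₂, u₂)}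

/-- `G'` arises from the cubic planar graph `G` by a contraction-elongation operation on an edge
`v₁ v₂`. In a planar embedding of `G`, one of the two faces along this edge has `u₁, v₁, v₂, u₃`
as consecutive boundary vertices and the other one has `u₄, v₂, v₁, u₂`. The new edge separates
the other two faces at `v₁` and `v₂`: its ends are joined to `u₁, u₃` and to `u₂, u₄`. -/
def IsContractionElongation {W : Type u} (G : SimpleGraph V) (G' : SimpleGraph W) : Prop :=
  ∃ R : G.RotationSystem, R.IsPlanar ∧ ∃ v₁ v₂ u₁ u₂ u₃ u₄ : V,
    R.Consecutive u₁ v₁ v₂ ∧ R.Consecutive v₁ v₂ u₃ ∧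
    R.Consecutive u₄ v₂ v₁ ∧ R.Consecutive v₂ v₁ u₂ ∧
    Nonempty (G' ≃g G.contractElongate v₁ v₂ u₂ u₃)

end SimpleGraph

/-!
Fix a rotation system of genus zero. For a cubic graph, three-connectedness is equivalent to
three-edge-connectedness (every edge cut has at least three edges), which is easier to follow under
local changes. A facial walk of length three is a triangle with distinct outer neighbours, unless
`G = K₄`, and the `ΔY` operation there decreases the number of vertices. A longer facial walk
`… x₀ x₁ x₂ x₃ x₄ …` is shortened by the contraction-elongation operation on `x₁ x₂`, which removes
`x₂` from it. This operation can only fail to preserve three-connectedness because of an edge cut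
with three edges that separates `x₁, x₂` from `x₀, x₃`. Submodularity of the cut size shows that
there are no such cuts for the two consecutive edges `x₁ x₂` and `x₂ x₃` at once, so one of them can
be operated on. Hence the length of a facial walk, and then the number of vertices, decreases until
`K₄` is reached.

Planarity is preserved because a labelling of the darts that is constant along faces transfers to
the new rotation system: it bounds the number of new faces from below, and Euler's formula turns
this bound into genus zero.
-/

namespace CubicMap

open SimpleGraph

/-! ### Euler's inequality and bridges, by linear algebra over `ZMod 2` -/

section LinearAlgebra

variable {K D : Type*} [Field K] [Finite D]

theorem finrank_ker_comp {L M N : Type*} [AddCommGroup L] [Module K L] [FiniteDimensional K L]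
    [AddCommGroup M] [Module K M] [AddCommGroup N] [Module K N]
    (f : M →ₗ[K] N) (g : L →ₗ[K] M) :
    Module.finrank K (f ∘ₗ g).ker =
      Module.finrank K g.ker + Module.finrank K (g.range ⊓ f.ker : Submodule K M) := by
  have rank_nullity := LinearMap.finrank_range_add_finrank_ker (g.domRestrict (f ∘ₗ g).ker)
  have range_eq : (g.domRestrict (f ∘ₗ g).ker).range = g.range ⊓ f.ker := by
    ext x
    constructor
    · rintro ⟨⟨y, hy⟩, rfl⟩
      exact ⟨⟨y, rfl⟩, hy⟩
    · rintro ⟨⟨y, rfl⟩, hy⟩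
      exact ⟨⟨y, hy⟩, rfl⟩
  have ker_eq : (g.domRestrict (f ∘ₗ g).ker).ker = g.ker.comap (f ∘ₗ g).ker.subtype := by
    ext x
    simp
  rw [range_eq, ker_eq,
    (Submodule.comapSubtypeEquivOfLe (LinearMap.ker_le_ker_comp g f)).finrank_eq] at rank_nullity
  omega

theorem finrank_ker_mulVecLin_transpose {D : Type*} [Fintype D]
    (A : Matrix D D K) :
    Module.finrank K A.transpose.mulVecLin.ker = Module.finrank K A.mulVecLin.ker := by
  classical
  have h := LinearMap.finrank_range_add_finrank_ker A.mulVecLin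
  have h' := LinearMap.finrank_range_add_finrank_ker A.transpose.mulVecLin
  have rank_eq := A.rank_transpose
  unfold Matrix.rank at rank_eq
  omega

theorem finrank_eq_card_of_mem_iff_factors {Q : Type*} {q : D → Q} (hq : Function.Surjective q)
    {p : Submodule K (D → K)} (hp : ∀ h, h ∈ p ↔ ∃ k : Q → K, h = k ∘ q) :
    Module.finrank K p = Nat.card Q := by
  have := Finite.of_surjective q hq
  have := Fintype.ofFinite Q
  have range_eq : (LinearMap.funLeft K K q).range = p := by
    ext h
    exact ⟨fun ⟨k, hk⟩ => (hp h).2 ⟨k, hk.symm⟩, fun hh => ((hp h).1 hh).imp fun _ => Eq.symm⟩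
  rw [← range_eq,
    LinearMap.finrank_range_of_inj (LinearMap.funLeft_injective_of_surjective K K q hq),
    Module.finrank_fintype_fun_eq_card, Nat.card_eq_fintype_card]

end LinearAlgebra

section Coboundary

variable {D : Type*} {σ : Equiv.Perm D}

theorem eq_of_sameCycle {X : Type*} {h : D → X} (hσ : ∀ d, h (σ d) = h d) {x y : D}
    (hxy : σ.SameCycle x y) : h x = h y := by
  obtain ⟨i, rfl⟩ := hxy
  induction i using Int.induction_on with
  | zero => simp
  | succ n ih => rw [add_comm, zpow_one_add, Equiv.Perm.mul_apply, hσ, ih]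
  | pred n ih =>
    rw [ih, ← hσ ((σ ^ (-(n : ℤ) - 1)) x), ← Equiv.Perm.mul_apply, ← zpow_one_add]
    congr 3
    ring

/-- The linear map `h ↦ h + h ∘ σ` on functions with values in `ZMod 2`. Its kernel consists of the
functions that are constant on the cycles of `σ`, and its range consists of the functions whose
sum over each cycle vanishes. -/
def coboundary (σ : Equiv.Perm D) : (D → ZMod 2) →ₗ[ZMod 2] (D → ZMod 2) :=
  LinearMap.id + LinearMap.funLeft (ZMod 2) (ZMod 2) σ

theorem coboundary_apply (h : D → ZMod 2) (d : D) : coboundary σ h d = h d + h (σ d) :=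
  rfl

theorem mem_ker_coboundary {h : D → ZMod 2} :
    h ∈ (coboundary σ).ker ↔ ∀ d, h (σ d) = h d := by
  simp only [LinearMap.mem_ker, funext_iff, coboundary_apply, Pi.zero_apply,
    CharTwo.add_eq_zero]
  exact forall_congr' fun d => eq_comm

theorem finrank_ker_coboundary [Finite D] :
    Module.finrank (ZMod 2) (coboundary σ).ker =
      Nat.card (Quotient (Equiv.Perm.SameCycle.setoid σ)) := by
  refine finrank_eq_card_of_mem_iff_factors (q := Quotient.mk _) Quotient.mk_surjective fun h => ?_
  rw [mem_ker_coboundary]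
  constructor
  · intro hσ
    exact ⟨Quotient.lift h fun x y hxy => eq_of_sameCycle hσ hxy, rfl⟩
  · rintro ⟨k, rfl⟩ d
    exact congrArg k (Quotient.sound (Equiv.Perm.sameCycle_apply_left.2 (.refl _ _)))

/-- The two composites are transposes of each other. -/
theorem finrank_ker_coboundary_comp [Finite D] (σ τ : Equiv.Perm D) :
    Module.finrank (ZMod 2) (coboundary σ ∘ₗ coboundary τ).ker =
      Module.finrank (ZMod 2) (coboundary τ⁻¹ ∘ₗ coboundary σ⁻¹).ker := by
  classical
  have := Fintype.ofFinite D
  have eq_mulVecLin : ∀ ρ : Equiv.Perm D,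
      coboundary ρ = (1 + ρ.permMatrix (ZMod 2)).mulVecLin := fun ρ => by
    refine LinearMap.ext fun h => funext fun d => ?_
    simp [coboundary_apply, Matrix.permMatrix_mulVec]
  rw [eq_mulVecLin σ, eq_mulVecLin τ, eq_mulVecLin σ⁻¹, eq_mulVecLin τ⁻¹,
    ← Matrix.mulVecLin_mul, ← Matrix.mulVecLin_mul, ← finrank_ker_mulVecLin_transpose,
    Matrix.transpose_mul, Matrix.transpose_add, Matrix.transpose_add, Matrix.transpose_one,
    Matrix.transpose_permMatrix, Matrix.transpose_permMatrix]

theorem single_add_single_mem_range_coboundary [DecidableEq D] {x y : D}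
    (hxy : σ.SameCycle x y) :
    (Pi.single x 1 + Pi.single y 1 : D → ZMod 2) ∈ (coboundary σ).range := by
  have class_eq : ∀ d, (coboundary σ).range.mkQ (Pi.single (σ d) 1) =
      (coboundary σ).range.mkQ (Pi.single d 1) := fun d => by
    refine (Submodule.Quotient.eq _).2 ⟨Pi.single (σ d) 1, funext fun e => ?_⟩
    simp [coboundary_apply, CharTwo.sub_eq_add, Pi.single_apply]
  have sub_mem := eq_of_sameCycle
    (h := fun d => (coboundary σ).range.mkQ (Pi.single d (1 : ZMod 2))) class_eq hxy
  rwa [Submodule.mkQ_apply, Submodule.mkQ_apply, Submodule.Quotient.eq,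
    ZModModule.sub_eq_add] at sub_mem

end Coboundary

section Rotation

variable {V : Type u} {G : SimpleGraph V}

/-- The edge boundary of a vertex set `S`: the edges with exactly one end in `S`, directed out
of `S`. -/
def edgeBoundary (G : SimpleGraph V) (S : Set V) : Set (V × V) :=
  {p | p.1 ∈ S ∧ p.2 ∉ S ∧ G.Adj p.1 p.2}

/-- The size of the edge cut between a vertex set `S` and its complement. -/
noncomputable def cutSize (G : SimpleGraph V) (S : Set V) : ℕ :=
  (edgeBoundary G S).ncard

instance [Finite V] : Finite G.Dart :=
  Finite.of_injective _ Dart.toProd_injective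

/-- The involution on darts that reverses their direction. -/
def reversal (G : SimpleGraph V) : Equiv.Perm G.Dart :=
  (Dart.symm_involutive (G := G)).toPerm

theorem reversal_apply (d : G.Dart) : reversal G d = d.symm :=
  rfl

theorem reversal_inv : (reversal G)⁻¹ = reversal G :=
  (Dart.symm_involutive (G := G)).toPerm_symm

theorem faceNext_apply (R : G.RotationSystem) (d : G.Dart) : R.faceNext d = R.rot d.symm :=
  rfl

theorem finrank_ker_coboundary_reversal [Finite V] :
    Module.finrank (ZMod 2) (coboundary (reversal G)).ker = Nat.card G.edgeSet := by
  have edge_surjective :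
      Function.Surjective fun d : G.Dart => (⟨d.edge, d.edge_mem⟩ : G.edgeSet) := by
    rintro ⟨⟨x, y⟩, hxy⟩
    exact ⟨⟨(x, y), hxy⟩, rfl⟩
  refine finrank_eq_card_of_mem_iff_factors edge_surjective fun h => ?_
  rw [mem_ker_coboundary]
  constructor
  · intro hs
    choose s hs' using edge_surjective
    refine ⟨fun e => h (s e), funext fun d => ?_⟩
    rcases (dart_edge_eq_iff _ _).1 (congrArg Subtype.val (hs' ⟨d.edge, d.edge_mem⟩)) with h' | h'
    · exact congrArg h h'.symm
    · exact (hs d).symm.trans (congrArg h h'.symm)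
  · rintro ⟨k, rfl⟩ d
    simp [reversal_apply]

theorem eq_of_forall_adj {X : Type*} (hG : G.Preconnected) {k : V → X}
    (hk : ∀ v w, G.Adj v w → k v = k w) (v w : V) : k v = k w := by
  obtain ⟨p⟩ := hG v w
  induction p with
  | nil => rfl
  | cons hadj _ ih => exact (hk _ _ hadj).trans ih

theorem exists_forall_eq_of_invariant {X : Type*} (R : G.RotationSystem) (hG : G.Connected)
    (hd : ∀ v, ∃ w, G.Adj v w) {h : G.Dart → X} (hsymm : ∀ d : G.Dart, h d.symm = h d)
    (hnext : ∀ d, h (R.faceNext d) = h d) : ∃ x, ∀ d, h d = x := by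
  have hrot : ∀ d, h (R.rot d) = h d := fun d => by
    rw [← hsymm d, ← hnext d.symm, faceNext_apply, Dart.symm_symm]
  choose w hw using hd
  have eq_at_fst : ∀ d : G.Dart, h d = h ⟨(d.fst, w d.fst), hw d.fst⟩ := fun d =>
    eq_of_sameCycle hrot (R.rot_cycle _ _ rfl)
  have adj_eq : ∀ u v, G.Adj u v → h ⟨(u, w u), hw u⟩ = h ⟨(v, w v), hw v⟩ := fun u v huv => by
    rw [← eq_at_fst ⟨(u, v), huv⟩, ← hsymm]
    exact eq_at_fst ⟨(v, u), huv.symm⟩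
  have ⟨v₀⟩ := hG.nonempty
  exact ⟨_, fun d => (eq_at_fst d).trans (eq_of_forall_adj hG.preconnected adj_eq d.fst v₀)⟩

theorem const_mem_range_coboundary_reversal (x : ZMod 2) :
    (fun _ => x) ∈ (coboundary (reversal G)).range := by
  classical
  let _ : LinearOrder V := WellOrderingRel.isWellOrder.linearOrder
  refine ⟨fun d => if d.fst < d.snd then x else 0, funext fun d => ?_⟩
  rw [coboundary_apply, reversal_apply]
  rcases lt_or_gt_of_ne d.fst_ne_snd with h | h <;> simp [h, h.le, not_lt]

theorem finrank_range_reversal_inf_ker_faceNext [Finite V] (R : G.RotationSystem)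
    (hG : G.Connected) (hd : ∀ v, ∃ w, G.Adj v w) :
    Module.finrank (ZMod 2) ((coboundary (reversal G)).range ⊓ (coboundary R.faceNext⁻¹).ker :
      Submodule (ZMod 2) (G.Dart → ZMod 2)) = 1 := by
  have ⟨v₀⟩ := hG.nonempty
  have ⟨w₀, hw₀⟩ := hd v₀
  refine (finrank_eq_card_of_mem_iff_factors (q := fun _ => ())
    (fun _ => ⟨⟨(v₀, w₀), hw₀⟩, rfl⟩) fun h => ?_).trans (Nat.card_unique (α := Unit))
  rw [Submodule.mem_inf, mem_ker_coboundary]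
  constructor
  · rintro ⟨⟨g, rfl⟩, hker⟩
    have hsymm : ∀ d : G.Dart,
        coboundary (reversal G) g d.symm = coboundary (reversal G) g d := fun d => by
      simp only [coboundary_apply, reversal_apply, Dart.symm_symm, add_comm]
    have ⟨x, hx⟩ := exists_forall_eq_of_invariant R hG hd hsymm fun d => by
      rw [← hker (R.faceNext d), Equiv.Perm.inv_def, Equiv.symm_apply_apply]
    exact ⟨fun _ => x, funext hx⟩
  · rintro ⟨k, rfl⟩
    exact ⟨const_mem_range_coboundary_reversal (k ()), fun _ => rfl⟩

theorem finrank_range_faceNext_inf_ker_reversal [Finite V] (R : G.RotationSystem)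
    (hG : G.Connected) (hd : ∀ v, ∃ w, G.Adj v w) :
    Nat.card R.Face + Module.finrank (ZMod 2)
      ((coboundary R.faceNext).range ⊓ (coboundary (reversal G)).ker :
        Submodule (ZMod 2) (G.Dart → ZMod 2)) = Nat.card G.edgeSet + 1 := by
  have e := finrank_ker_coboundary_comp (reversal G) R.faceNext
  rw [finrank_ker_comp, finrank_ker_comp, reversal_inv, finrank_ker_coboundary,
    finrank_ker_coboundary_reversal, finrank_range_reversal_inf_ker_faceNext R hG hd] at e
  exact e

/-- The linear map sending `φ : V → ZMod 2` to the function `d ↦ φ d.fst + φ d.snd` on darts, which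
marks the edges of the cut described by `φ`. -/
def gradient (G : SimpleGraph V) : (V → ZMod 2) →ₗ[ZMod 2] (G.Dart → ZMod 2) :=
  LinearMap.funLeft (ZMod 2) (ZMod 2) (fun d : G.Dart => d.fst) +
    LinearMap.funLeft (ZMod 2) (ZMod 2) (fun d : G.Dart => d.snd)

theorem gradient_apply (φ : V → ZMod 2) (d : G.Dart) : gradient G φ d = φ d.fst + φ d.snd :=
  rfl

theorem finrank_range_gradient [Finite V] (hG : G.Connected) :
    Module.finrank (ZMod 2) (gradient G).range + 1 = Nat.card V := by
  have := Fintype.ofFinite V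
  have ⟨v₀⟩ := hG.nonempty
  have ker_eq : Module.finrank (ZMod 2) (gradient G).ker = 1 := by
    refine (finrank_eq_card_of_mem_iff_factors (q := fun _ => ())
      (fun _ => ⟨v₀, rfl⟩) fun φ => ?_).trans (Nat.card_unique (α := Unit))
    constructor
    · intro hφ
      refine ⟨fun _ => φ v₀, funext fun v => eq_of_forall_adj hG.preconnected ?_ v v₀⟩
      exact fun u w huw => CharTwo.add_eq_zero.1 (congrFun hφ ⟨(u, w), huw⟩)
    · rintro ⟨k, rfl⟩
      exact funext fun d => CharTwo.add_self_eq_zero _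
  rw [← ker_eq, LinearMap.finrank_range_add_finrank_ker, Module.finrank_fintype_fun_eq_card,
    Nat.card_eq_fintype_card]

theorem range_gradient_le (R : G.RotationSystem) :
    (gradient G).range ≤ (coboundary R.faceNext).range ⊓ (coboundary (reversal G)).ker := by
  rintro _ ⟨φ, rfl⟩
  refine ⟨⟨fun d => φ d.fst, funext fun d => ?_⟩, mem_ker_coboundary.2 fun d => ?_⟩
  · rw [coboundary_apply, gradient_apply, faceNext_apply, R.rot_fst]
    rfl
  · exact add_comm _ _

theorem card_add_card_face_le [Finite V] (R : G.RotationSystem) (hG : G.Connected)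
    (hd : ∀ v, ∃ w, G.Adj v w) :
    Nat.card V + Nat.card R.Face ≤ Nat.card G.edgeSet + 2 := by
  have hV := finrank_range_gradient hG
  have hF := finrank_range_faceNext_inf_ker_reversal R hG hd
  have hle := Submodule.finrank_mono (range_gradient_le R)
  omega

theorem isPlanar_iff_card [Finite V] (R : G.RotationSystem) (hG : G.Connected)
    (hd : ∀ v, ∃ w, G.Adj v w) :
    R.IsPlanar ↔ Nat.card V + Nat.card R.Face = Nat.card G.edgeSet + 2 := by
  have ⟨v₀⟩ := hG.nonempty
  have := hG.preconnected.subsingleton_connectedComponent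
  have : Nonempty G.ConnectedComponent := ⟨G.connectedComponentMk v₀⟩
  have : IsEmpty {v : V // ∀ w, ¬ G.Adj v w} := ⟨fun v => (hd v).elim v.2⟩
  rw [RotationSystem.IsPlanar, Nat.card_unique (α := G.ConnectedComponent),
    Nat.card_of_isEmpty (α := {v : V // ∀ w, ¬ G.Adj v w}), add_zero, mul_one]

theorem range_gradient_eq [Finite V] {R : G.RotationSystem} (hR : R.IsPlanar)
    (hG : G.Connected) (hd : ∀ v, ∃ w, G.Adj v w) :
    (gradient G).range = (coboundary R.faceNext).range ⊓ (coboundary (reversal G)).ker := by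
  have hV := finrank_range_gradient hG
  have hF := finrank_range_faceNext_inf_ker_reversal R hG hd
  have euler := (isPlanar_iff_card R hG hd).1 hR
  exact Submodule.eq_of_le_of_finrank_eq (range_gradient_le R) (by omega)

theorem exists_cutSize_eq_one_of_sameCycle_symm [Finite V] {R : G.RotationSystem}
    (hR : R.IsPlanar) (hG : G.Connected) (hd : ∀ v, ∃ w, G.Adj v w) {d : G.Dart}
    (hface : R.faceNext.SameCycle d d.symm) : ∃ S : Set V, cutSize G S = 1 := by
  classical
  have hmem : (Pi.single d 1 + Pi.single d.symm 1 : G.Dart → ZMod 2) ∈ (gradient G).range := by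
    rw [range_gradient_eq hR hG hd]
    refine ⟨single_add_single_mem_range_coboundary hface, mem_ker_coboundary.2 fun e => ?_⟩
    have symm_eq : e.symm = d ↔ e = d.symm := Dart.symm_involutive.eq_iff
    simp [Pi.single_apply, reversal_apply, symm_eq, Dart.symm_involutive.injective.eq_iff, add_comm]
  obtain ⟨φ, hφ⟩ := hmem
  have cut_iff : ∀ e : G.Dart, φ e.fst ≠ φ e.snd ↔ e = d ∨ e = d.symm := fun e => by
    have hφe := congrFun hφ e
    rw [gradient_apply, Pi.add_apply] at hφe
    rw [Ne, ← CharTwo.add_eq_zero, hφe]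
    by_cases h : e = d <;> by_cases h' : e = d.symm <;>
      simp_all [d.symm_ne, d.symm_ne.symm]
  refine ⟨{v | φ v = φ d.fst}, Set.ncard_eq_one.2 ⟨d.toProd, Set.ext fun ⟨u, v⟩ => ?_⟩⟩
  constructor
  · rintro ⟨hu : φ u = _, hv : φ v ≠ _, huv : G.Adj u v⟩
    rcases (cut_iff ⟨(u, v), huv⟩).1 (hu.trans_ne hv.symm) with h | h
    · exact congrArg Dart.toProd h
    · have hv' : v = d.fst := congrArg (fun e : G.Dart => e.snd) h
      exact absurd (congrArg φ hv') hv
  · intro h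
    rw [Set.mem_singleton_iff.1 h]
    exact ⟨rfl, ((cut_iff d).2 (.inl rfl)).symm, d.adj⟩

end Rotation

/-! ### Edge cuts of cubic graphs -/

section Cuts

variable {V : Type u} {G : SimpleGraph V} {S T : Set V}

/-- A graph is three-edge-connected if every edge cut has at least three edges. -/
def IsThreeEdgeConnected (G : SimpleGraph V) : Prop :=
  ∀ S : Set V, S.Nonempty → S ≠ Set.univ → 3 ≤ cutSize G S

theorem cutSize_compl (S : Set V) : cutSize G Sᶜ = cutSize G S := by
  have swap_image : Prod.swap '' edgeBoundary G S = edgeBoundary G Sᶜ := by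
    ext ⟨u, v⟩
    simp only [edgeBoundary, Set.image_swap_eq_preimage_swap, Set.mem_preimage, Set.mem_ofPred_eq,
      Prod.fst_swap, Prod.snd_swap, Set.mem_compl_iff, not_not, G.adj_comm v u]
    tauto
  rw [cutSize, ← swap_image, Set.ncard_image_of_injective _ Prod.swap_injective, cutSize]

theorem cutSize_inter_add_cutSize_union_le [Finite V] (S T : Set V) :
    cutSize G (S ∩ T) + cutSize G (S ∪ T) ≤ cutSize G S + cutSize G T := by
  simp only [cutSize]
  rw [← Set.ncard_union_add_ncard_inter, ← Set.ncard_union_add_ncard_inter (edgeBoundary G S)]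
  refine add_le_add (Set.ncard_le_ncard ?_) (Set.ncard_le_ncard ?_) <;> intro p
  · simp only [edgeBoundary, Set.mem_union, Set.mem_inter_iff, Set.mem_ofPred_eq]
    tauto
  · simp only [edgeBoundary, Set.mem_union, Set.mem_inter_iff, Set.mem_ofPred_eq]
    tauto

theorem cutSize_insert [Finite V] {v : V} (hv : v ∉ S) :
    cutSize G (insert v S) + (G.neighborSet v ∩ S).ncard =
      cutSize G S + (G.neighborSet v \ S).ncard := by
  have union_eq : edgeBoundary G (insert v S) ∪ (fun w => (w, v)) '' (G.neighborSet v ∩ S) =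
      edgeBoundary G S ∪ (fun w => (v, w)) '' (G.neighborSet v \ S) := by
    ext ⟨a, b⟩
    by_cases ha : a = v <;> by_cases hb : b = v <;>
      simp_all [edgeBoundary, G.adj_comm, and_comm, eq_comm]
  have disjoint_left :
      Disjoint (edgeBoundary G (insert v S)) ((fun w => (w, v)) '' (G.neighborSet v ∩ S)) := by
    rw [Set.disjoint_right]
    rintro _ ⟨w, -, rfl⟩ h
    exact h.2.1 (Set.mem_insert _ _)
  have disjoint_right :
      Disjoint (edgeBoundary G S) ((fun w => (v, w)) '' (G.neighborSet v \ S)) := by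
    rw [Set.disjoint_right]
    rintro _ ⟨w, -, rfl⟩ h
    exact hv h.1
  have card_eq := congrArg Set.ncard union_eq
  rwa [Set.ncard_union_eq disjoint_left, Set.ncard_union_eq disjoint_right,
    Set.ncard_image_of_injective _ (Prod.mk_left_injective v),
    Set.ncard_image_of_injective _ (Prod.mk_right_injective v)] at card_eq

theorem ncard_neighborSet_inter_add_sdiff [Finite V] (hG : G.IsCubic) (v : V) (S : Set V) :
    (G.neighborSet v ∩ S).ncard + (G.neighborSet v \ S).ncard = 3 :=
  (Set.ncard_inter_add_ncard_sdiff_eq_ncard _ _).trans (hG v)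

theorem cutSize_insert_le [Finite V] (hG : G.IsCubic) {v a : V} (hv : v ∉ S) (ha : G.Adj v a)
    (haS : a ∈ S) : cutSize G (insert v S) ≤ cutSize G S + 1 := by
  have one_le : ({a} : Set V).ncard ≤ (G.neighborSet v ∩ S).ncard :=
    Set.ncard_le_ncard (Set.singleton_subset_iff.2 ⟨ha, haS⟩)
  rw [Set.ncard_singleton] at one_le
  have := cutSize_insert (G := G) hv
  have := ncard_neighborSet_inter_add_sdiff hG v S
  omega

theorem cutSize_insert_lt [Finite V] (hG : G.IsCubic) {v a b : V} (hv : v ∉ S) (ha : G.Adj v a)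
    (haS : a ∈ S) (hb : G.Adj v b) (hbS : b ∈ S) (hab : a ≠ b) :
    cutSize G (insert v S) < cutSize G S := by
  have two_le : ({a, b} : Set V).ncard ≤ (G.neighborSet v ∩ S).ncard :=
    Set.ncard_le_ncard (Set.pair_subset ⟨ha, haS⟩ ⟨hb, hbS⟩)
  rw [Set.ncard_pair hab] at two_le
  have := cutSize_insert (G := G) hv
  have := ncard_neighborSet_inter_add_sdiff hG v S
  omega

theorem cutSize_singleton [Finite V] (hG : G.IsCubic) (v : V) : cutSize G {v} = 3 := by
  have insert_empty := cutSize_insert (G := G) (Set.notMem_empty v)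
  have cut_empty : cutSize G ∅ = 0 := by simp [cutSize, edgeBoundary]
  rwa [insert_empty_eq, Set.inter_empty, Set.sdiff_empty, hG v, cut_empty, Set.ncard_empty]
    at insert_empty

theorem three_le_cutSize_pair [Finite V] (hG : G.IsCubic) {v w : V} (hvw : v ≠ w) :
    3 ≤ cutSize G {v, w} := by
  have inter_le : (G.neighborSet v ∩ {w}).ncard ≤ 1 :=
    (Set.ncard_le_ncard Set.inter_subset_right).trans_eq (Set.ncard_singleton w)
  have := cutSize_insert (G := G) (v := v) (S := {w}) hvw
  have := ncard_neighborSet_inter_add_sdiff hG v {w}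
  have := cutSize_singleton hG w
  omega

theorem subset_image_fst_edgeBoundary [Finite V] (hG : G.IsThreeConnected)
    (hS : cutSize G S < 3) (hne : S ≠ Set.univ) : S ⊆ Prod.fst '' edgeBoundary G S := by
  classical
  have := Fintype.ofFinite V
  intro v hv
  by_contra hvP
  obtain ⟨w, hw⟩ := (Set.ne_univ_iff_exists_notMem S).1 hne
  set P := Prod.fst '' edgeBoundary G S
  have card_lt : P.toFinset.card < 3 := by
    rw [← Set.ncard_eq_toFinset_card']
    exact (Set.ncard_image_le (Set.toFinite _)).trans_lt hS
  have hwP : w ∉ P := by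
    rintro ⟨p, hp, rfl⟩
    exact hw hp.1
  obtain ⟨walk⟩ := (hG.2 P.toFinset card_lt).preconnected
    ⟨v, by simpa using hvP⟩ ⟨w, by simpa using hwP⟩
  obtain ⟨d, -, hd, hd'⟩ := walk.exists_boundary_dart {x | (x : V) ∈ S} hv hw
  exact d.fst.2 (Set.mem_toFinset.2 ⟨(d.fst.1, d.snd.1), ⟨hd, hd', d.adj⟩, rfl⟩)

theorem isThreeEdgeConnected_of_isThreeConnected [Finite V] (hG : G.IsCubic)
    (hconn : G.IsThreeConnected) : IsThreeEdgeConnected G := by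
  intro S hne huniv
  by_contra! hS
  have card_le : S.ncard ≤ 2 :=
    (Set.ncard_le_ncard (subset_image_fst_edgeBoundary hconn hS huniv)).trans
      ((Set.ncard_image_le (Set.toFinite _)).trans (Nat.lt_succ_iff.1 hS))
  have card_pos := (Set.ncard_pos (Set.toFinite S)).2 hne
  obtain h | h : S.ncard = 1 ∨ S.ncard = 2 := by omega
  · obtain ⟨v, rfl⟩ := Set.ncard_eq_one.1 h
    exact hS.ne (cutSize_singleton hG v)
  · obtain ⟨v, w, hvw, rfl⟩ := Set.ncard_eq_two.1 h
    exact hS.not_ge (three_le_cutSize_pair hG hvw)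

theorem card_gt_three [Finite V] [Nonempty V] (hG : G.IsCubic) : 3 < Nat.card V := by
  have ⟨v⟩ := ‹Nonempty V›
  have card_le := Set.ncard_le_card (insert v (G.neighborSet v))
  rwa [Set.ncard_insert_of_notMem (G.notMem_neighborSet_self), hG v] at card_le

theorem connected_of_isThreeEdgeConnected [Nonempty V] (hG : IsThreeEdgeConnected G) :
    G.Connected := by
  refine connected_iff_exists_forall_reachable G |>.2 ?_
  have ⟨u⟩ := ‹Nonempty V›
  refine ⟨u, fun v => ?_⟩
  by_contra hv
  have boundary_empty : edgeBoundary G {w | G.Reachable u w} = ∅ :=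
    Set.eq_empty_of_forall_notMem fun p hp => hp.2.1 (hp.1.trans hp.2.2.reachable)
  have three_le := hG {w | G.Reachable u w} ⟨u, .rfl⟩ fun h => hv (Set.eq_univ_iff_forall.1 h v)
  rw [cutSize, boundary_empty, Set.ncard_empty] at three_le
  omega

theorem exists_cutSize_le_ncard [Finite V] (hG : G.IsCubic) {A S : Set V}
    (hA : ∀ u ∈ A, ∀ v, G.Adj u v → v ∈ A ∪ S) :
    ∃ X, A ⊆ X ∧ X ⊆ A ∪ S ∧ cutSize G X ≤ S.ncard := by
  classical
  -- A vertex of `S` outside `X` sends at most one edge into `A`, and one in `X` sends at most one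
  -- edge out of `A`, so the edges leaving `X` belong to different vertices of `S`.
  let X := A ∪ {v ∈ S | (G.neighborSet v \ A).ncard ≤ 1}
  refine ⟨X, Set.subset_union_left,
    Set.union_subset_union_right A (Set.sep_subset _ _),
    Set.ncard_le_ncard_of_injOn (fun p => if p.1 ∈ A then p.2 else p.1) ?_ ?_⟩
  · rintro ⟨a, b⟩ ⟨ha, hb, hab : G.Adj a b⟩
    by_cases haA : a ∈ A
    · have hbS : b ∈ S := (hA a haA b hab).resolve_left fun h => hb (.inl h)
      simpa only [haA, if_true] using hbS
    · simpa only [haA, if_false] using (ha.resolve_left haA).1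
  · rintro ⟨a, b⟩ ⟨ha, hb, hab : G.Adj a b⟩ ⟨a', b'⟩ ⟨ha', hb', hab' : G.Adj a' b'⟩ h
    have inter_le : ∀ s ∈ S, s ∉ X → (G.neighborSet s ∩ A).ncard ≤ 1 := fun s hs hsX => by
      have := ncard_neighborSet_inter_add_sdiff hG s A
      have : ¬ (G.neighborSet s \ A).ncard ≤ 1 := fun h => hsX (.inr ⟨hs, h⟩)
      omega
    by_cases haA : a ∈ A <;> by_cases haA' : a' ∈ A <;>
      simp only [haA, haA', if_true, if_false] at h
    · subst h
      have hbS : b ∈ S := (hA a haA b hab).resolve_left fun h => hb (.inl h)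
      rw [(Set.ncard_le_one (Set.toFinite _)).1 (inter_le b hbS hb) a ⟨hab.symm, haA⟩ a'
        ⟨hab'.symm, haA'⟩]
    · exact absurd (h ▸ ha') hb
    · exact absurd (h ▸ ha) hb'
    · subst h
      rw [(Set.ncard_le_one (Set.toFinite _)).1 (ha.resolve_left haA).2 b
        ⟨hab, fun h => hb (.inl h)⟩ b' ⟨hab', fun h => hb' (.inl h)⟩]

theorem isThreeConnected_of_isThreeEdgeConnected [Finite V] [Nonempty V] (hG : G.IsCubic)
    (hconn : IsThreeEdgeConnected G) : G.IsThreeConnected := by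
  have card_gt := card_gt_three hG
  refine ⟨card_gt, fun S hS => ?_⟩
  obtain ⟨u, hu⟩ : ∃ u, u ∉ S := by
    by_contra! h
    have := Set.ncard_le_ncard fun v (_ : v ∈ Set.univ) => Finset.mem_coe.2 (h v)
    rw [Set.ncard_univ, Set.ncard_coe_finset] at this
    omega
  refine connected_iff_exists_forall_reachable _ |>.2 ⟨⟨u, hu⟩, fun ⟨w, hw⟩ => ?_⟩
  by_contra hw'
  set A : Set V := Subtype.val '' {v | (G.induce {v | v ∉ S}).Reachable ⟨u, hu⟩ v}
  have closed : ∀ a ∈ A, ∀ v, G.Adj a v → v ∈ A ∪ S := by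
    rintro _ ⟨⟨a, ha⟩, hua, rfl⟩ v hav
    refine or_iff_not_imp_right.2 fun hv => ⟨⟨v, hv⟩, hua.trans (Adj.reachable ?_), rfl⟩
    exact hav
  obtain ⟨X, hAX, hXA, hX⟩ := exists_cutSize_le_ncard hG closed
  have huX : u ∈ X := hAX ⟨⟨u, hu⟩, .rfl, rfl⟩
  have hwX : w ∉ X := fun h => by
    rcases hXA h with ⟨v, hv, rfl⟩ | h
    · exact hw' hv
    · exact hw h
  have three_le := hconn X ⟨u, huX⟩ fun h => hwX (h ▸ Set.mem_univ w)
  rw [Set.ncard_coe_finset] at hX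
  omega

end Cuts

/-! ### Rotations of cubic graphs and their faces -/

section CubicRotation

variable {V : Type u} {G : SimpleGraph V} {f : V → V → V}

/-- A rotation system of a cubic graph, given by a function of two vertices: `f v` permutes the
three neighbours of `v` cyclically. The values `f v w` for `w` not adjacent to `v` are
irrelevant. -/
def IsCubicRotation (G : SimpleGraph V) (f : V → V → V) : Prop :=
  ∀ v, ∃ p q r, p ≠ q ∧ p ≠ r ∧ q ≠ r ∧ (∀ w, G.Adj v w ↔ w = p ∨ w = q ∨ w = r) ∧
    f v p = q ∧ f v q = r ∧ f v r = p

namespace IsCubicRotation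

variable {v w x : V}

theorem adj (hf : IsCubicRotation G f) (h : G.Adj v w) : G.Adj v (f v w) := by
  obtain ⟨p, q, r, -, -, -, hadj, hp, hq, hr⟩ := hf v
  rw [hadj] at h ⊢
  rcases h with rfl | rfl | rfl <;> simp [*]

theorem ne (hf : IsCubicRotation G f) (h : G.Adj v w) : f v w ≠ w := by
  obtain ⟨p, q, r, hpq, hpr, hqr, hadj, hp, hq, hr⟩ := hf v
  rcases (hadj w).1 h with rfl | rfl | rfl
  · exact hp ▸ hpq.symm
  · exact hq ▸ hqr.symm
  · exact hr ▸ hpr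

theorem cube (hf : IsCubicRotation G f) (h : G.Adj v w) : f v (f v (f v w)) = w := by
  obtain ⟨p, q, r, -, -, -, hadj, hp, hq, hr⟩ := hf v
  rcases (hadj w).1 h with rfl | rfl | rfl <;> simp [*]

theorem adj_iff (hf : IsCubicRotation G f) (h : G.Adj v w) :
    G.Adj v x ↔ x = w ∨ x = f v w ∨ x = f v (f v w) := by
  obtain ⟨p, q, r, -, -, -, hadj, hp, hq, hr⟩ := hf v
  rw [hadj]
  rcases (hadj w).1 h with rfl | rfl | rfl <;> simp only [hp, hq, hr] <;> tauto

theorem inj (hf : IsCubicRotation G f) (hw : G.Adj v w) (hx : G.Adj v x)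
    (h : f v w = f v x) : w = x := by
  rw [← hf.cube hw, h, hf.cube hx]

theorem exists_adj (hf : IsCubicRotation G f) (v : V) : ∃ w, G.Adj v w :=
  have ⟨p, _, _, _, _, _, hadj, _⟩ := hf v
  ⟨p, (hadj p).2 (.inl rfl)⟩

theorem isCubic (hf : IsCubicRotation G f) : G.IsCubic := fun v =>
  have ⟨p, q, r, hpq, hpr, hqr, hadj, _⟩ := hf v
  Set.ncard_eq_three.2 ⟨p, q, r, hpq, hpr, hqr, Set.ext hadj⟩

/-- The rotation system described by `f`. -/
def toRotationSystem (hf : IsCubicRotation G f) : G.RotationSystem where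
  rot :=
    { toFun := fun d => ⟨(d.fst, f d.fst d.snd), hf.adj d.adj⟩
      invFun := fun d => ⟨(d.fst, f d.fst (f d.fst d.snd)), hf.adj (hf.adj d.adj)⟩
      left_inv := fun d => Dart.ext _ _ (Prod.ext rfl (hf.cube d.adj))
      right_inv := fun d => Dart.ext _ _ (Prod.ext rfl (hf.cube d.adj)) }
  rot_fst := fun _ => rfl
  rot_cycle := by
    rintro ⟨⟨u, v⟩, huv⟩ ⟨⟨u', w⟩, huw⟩ h
    obtain rfl : u = u' := h
    rcases (hf.adj_iff huv).1 huw with rfl | rfl | rfl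
    · exact .refl _ _
    · exact ⟨1, rfl⟩
    · exact ⟨2, rfl⟩

theorem consecutive (hf : IsCubicRotation G f) (h : G.Adj v w) :
    hf.toRotationSystem.Consecutive v w (f w v) :=
  ⟨h, hf.adj h.symm, rfl⟩

end IsCubicRotation

theorem rot_rot_ne [Finite V] (R : G.RotationSystem) (hG : G.IsCubic) (d : G.Dart) :
    R.rot (R.rot d) ≠ d := by
  intro fixed
  have invariant : ∀ e, (R.rot e = d ∨ R.rot e = R.rot d) = (e = d ∨ e = R.rot d) := fun e => by
    rw [R.rot.injective.eq_iff, or_comm, ← R.rot.injective.eq_iff (b := R.rot d), fixed]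
  have neighbors_subset : G.neighborSet d.fst ⊆ {d.snd, (R.rot d).snd} := fun w hw =>
    have same := R.rot_cycle d ⟨(d.fst, w), hw⟩ rfl
    have mem := (eq_of_sameCycle (h := fun e => e = d ∨ e = R.rot d) invariant same).mp (.inl rfl)
    mem.imp (congrArg fun e : G.Dart => e.snd) (congrArg fun e : G.Dart => e.snd)
  have card_le := (Set.ncard_le_ncard neighbors_subset).trans (Set.ncard_insert_le _ _)
  rw [hG, Set.ncard_singleton] at card_le
  omega

theorem neighborSet_eq [Finite V] (hG : G.IsCubic) {v a b c : V} (ha : G.Adj v a)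
    (hb : G.Adj v b) (hc : G.Adj v c) (hab : a ≠ b) (hac : a ≠ c) (hbc : b ≠ c) (w : V) :
    G.Adj v w ↔ w = a ∨ w = b ∨ w = c := by
  have subset : {a, b, c} ⊆ G.neighborSet v := by
    rintro _ (rfl | rfl | rfl)
    · exact ha
    · exact hb
    · exact hc
  have card_eq := (Set.ncard_eq_three.2 ⟨a, b, c, hab, hac, hbc, rfl⟩ : _ = 3)
  have set_eq := Set.eq_of_subset_of_ncard_le subset ((hG v).trans card_eq.symm).le
  exact (Set.ext_iff.1 set_eq w).symm

theorem rotationSystem_ext {R R' : G.RotationSystem} (h : R.rot = R'.rot) : R = R' := by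
  obtain ⟨rot, _, _⟩ := R
  subst h
  rfl

theorem exists_toRotationSystem_eq [Finite V] (R : G.RotationSystem) (hG : G.IsCubic) :
    ∃ (f : V → V → V) (hf : IsCubicRotation G f), hf.toRotationSystem = R := by
  classical
  let f : V → V → V := fun u v => if h : G.Adj u v then (R.rot ⟨(u, v), h⟩).snd else v
  have f_eq : ∀ d : G.Dart, f d.fst d.snd = (R.rot d).snd := fun d => dif_pos d.adj
  have rot_eq : ∀ d : G.Dart, (R.rot d).toProd = (d.fst, f d.fst d.snd) := fun d =>
    Prod.ext (R.rot_fst d) (f_eq d).symm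
  have hf : IsCubicRotation G f := by
    intro v
    obtain ⟨p, hp : G.Adj v p⟩ : (G.neighborSet v).Nonempty :=
      Set.nonempty_of_ncard_ne_zero (by rw [hG v]; norm_num)
    have adj : ∀ w, G.Adj v w → G.Adj v (f v w) := fun w hw => by
      have d_adj := (R.rot ⟨(v, w), hw⟩).adj
      rwa [rot_eq] at d_adj
    have inj : ∀ w w', G.Adj v w → G.Adj v w' → f v w = f v w' → w = w' := fun w w' hw hw' h =>
      congrArg (fun d : G.Dart => d.snd) (R.rot.injective (Dart.ext _ _
        ((rot_eq ⟨(v, w), hw⟩).trans ((congrArg (Prod.mk v) h).trans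
          (rot_eq ⟨(v, w'), hw'⟩).symm))))
    have sq_ne : f v (f v p) ≠ p := fun h => rot_rot_ne R hG ⟨(v, p), hp⟩ <| Dart.ext _ _ <| by
      rw [rot_eq, rot_eq]
      exact congrArg (Prod.mk v) h
    have ne : f v p ≠ p := fun h => sq_ne ((congrArg (f v) h).trans h)
    have ne' : f v p ≠ f v (f v p) := fun h => ne (inj _ _ hp (adj _ hp) h).symm
    have adj_iff := neighborSet_eq hG hp (adj _ hp) (adj _ (adj _ hp)) ne.symm sq_ne.symm ne'
    refine ⟨p, _, _, ne.symm, sq_ne.symm, ne', adj_iff, rfl, rfl, ?_⟩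
    rcases (adj_iff _).1 (adj _ (adj _ (adj _ hp))) with h | h | h
    · exact h
    · exact absurd (inj _ _ (adj _ (adj _ hp)) hp h) sq_ne
    · exact absurd (inj _ _ (adj _ (adj _ hp)) (adj _ hp) h) ne'.symm
  exact ⟨f, hf, rotationSystem_ext (Equiv.ext fun d => Dart.ext _ _ (rot_eq d).symm)⟩

/-- A labelling of the faces of a rotation system, not necessarily injective: `c u v` is the label
of the face along `u → v`, and the values at nonadjacent vertices are irrelevant. -/
def IsFaceLabelling (G : SimpleGraph V) (f : V → V → V) {X : Type*} (c : V → V → X) : Prop :=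
  ∀ u v, G.Adj u v → c v (f v u) = c u v

/-- The labels that occur in a labelling of the faces. -/
def faceLabels (G : SimpleGraph V) {X : Type*} (c : V → V → X) : Set X :=
  {label | ∃ u v, G.Adj u v ∧ c u v = label}

theorem IsFaceLabelling.ncard_faceLabels_le [Finite V] {X : Type*} {c : V → V → X}
    (hc : IsFaceLabelling G f c) (hf : IsCubicRotation G f) :
    (faceLabels G c).ncard ≤ Nat.card hf.toRotationSystem.Face := by
  have : Finite hf.toRotationSystem.Face := Quotient.finite _
  have invariant : ∀ d : G.Dart, c (hf.toRotationSystem.faceNext d).fst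
      (hf.toRotationSystem.faceNext d).snd = c d.fst d.snd := fun d => hc _ _ d.adj
  let label : hf.toRotationSystem.Face → X :=
    Quotient.lift (fun d : G.Dart => c d.fst d.snd) fun _ _ h =>
      eq_of_sameCycle (h := fun d : G.Dart => c d.fst d.snd) invariant h
  rw [← Set.ncard_univ]
  refine (Set.ncard_le_ncard ?_ (Set.toFinite _)).trans
    (Set.ncard_image_le (f := label) Set.finite_univ)
  rintro _ ⟨u, v, huv, rfl⟩
  exact ⟨Quotient.mk _ ⟨(u, v), huv⟩, Set.mem_univ _, rfl⟩

theorem IsCubicRotation.exists_faceLabelling [Nonempty V] (hf : IsCubicRotation G f) :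
    ∃ c : V → V → hf.toRotationSystem.Face,
      IsFaceLabelling G f c ∧ faceLabels G c = Set.univ := by
  classical
  have ⟨v₀⟩ := ‹Nonempty V›
  have ⟨w₀, h₀⟩ := hf.exists_adj v₀
  let face : G.Dart → hf.toRotationSystem.Face := Quotient.mk _
  let c : V → V → hf.toRotationSystem.Face := fun u v =>
    if h : G.Adj u v then face ⟨(u, v), h⟩ else face ⟨(v₀, w₀), h₀⟩
  have c_eq : ∀ d : G.Dart, c d.fst d.snd = face d := fun d => dif_pos d.adj
  refine ⟨c, fun u v huv => ?_, Set.eq_univ_of_forall fun x => ?_⟩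
  · refine (c_eq ⟨(v, f v u), hf.adj huv.symm⟩).trans (Eq.trans ?_ (c_eq ⟨(u, v), huv⟩).symm)
    exact Quotient.sound (Equiv.Perm.SameCycle.symm ⟨1, rfl⟩)
  · obtain ⟨d, rfl⟩ := Quotient.exists_rep x
    exact ⟨d.fst, d.snd, d.adj, c_eq d⟩

theorem two_mul_card_edgeSet [Finite V] (hG : G.IsCubic) :
    2 * Nat.card G.edgeSet = 3 * Nat.card V := by
  classical
  have := Fintype.ofFinite V
  have degree_eq : ∀ v, G.degree v = 3 := fun v => by
    rw [← hG v, ← G.card_neighborSet_eq_degree, Set.ncard_eq_toFinset_card', Set.toFinset_card]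
  have sum_eq := G.sum_degrees_eq_twice_card_edges
  rwa [Finset.sum_congr rfl fun v _ => degree_eq v, Finset.sum_const, Finset.card_univ,
    smul_eq_mul, mul_comm, ← Nat.card_eq_fintype_card, G.edgeFinset_card,
    ← Nat.card_eq_fintype_card, eq_comm] at sum_eq

/-- A planar embedding of a three-edge-connected cubic graph, given by the function `f` of an
`IsCubicRotation`. -/
structure IsPlanarCubicMap (G : SimpleGraph V) (f : V → V → V) : Prop where
  rot : IsCubicRotation G f
  conn : IsThreeEdgeConnected G
  planar : rot.toRotationSystem.IsPlanar

theorem exists_isPlanarCubicMap [Finite V] (hG : G.IsCubic) (hconn : G.IsThreeConnected)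
    (hplanar : G.IsPlanar) : ∃ f, IsPlanarCubicMap G f := by
  obtain ⟨R, hR⟩ := hplanar
  obtain ⟨f, hf, rfl⟩ := exists_toRotationSystem_eq R hG
  exact ⟨f, hf, isThreeEdgeConnected_of_isThreeConnected hG hconn, hR⟩

namespace IsPlanarCubicMap

variable [Finite V] [Nonempty V]

theorem isThreeConnected (hf : IsPlanarCubicMap G f) : G.IsThreeConnected :=
  isThreeConnected_of_isThreeEdgeConnected hf.rot.isCubic hf.conn

theorem two_mul_card_face (hf : IsPlanarCubicMap G f) :
    2 * Nat.card hf.rot.toRotationSystem.Face = Nat.card V + 4 := by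
  have euler := (isPlanar_iff_card _ (connected_of_isThreeEdgeConnected hf.conn)
    hf.rot.exists_adj).1 hf.planar
  have := two_mul_card_edgeSet hf.rot.isCubic
  omega

theorem of_card_le (hf : IsCubicRotation G f) (hconn : IsThreeEdgeConnected G)
    (hcard : Nat.card V + 4 ≤ 2 * Nat.card hf.toRotationSystem.Face) :
    IsPlanarCubicMap G f := by
  have connected := connected_of_isThreeEdgeConnected hconn
  refine ⟨hf, hconn, (isPlanar_iff_card _ connected hf.exists_adj).2 ?_⟩
  have := card_add_card_face_le hf.toRotationSystem connected hf.exists_adj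
  have := two_mul_card_edgeSet hf.isCubic
  omega

end IsPlanarCubicMap

end CubicRotation

/-! ### Contraction-elongation -/

section Flip

variable {V : Type u} {G : SimpleGraph V} {f : V → V → V} {v₁ v₂ u₁ u₂ u₃ u₄ a b : V} {S : Set V}

/-- The surroundings of an edge `v₁ v₂`, labelled as in `IsContractionElongation`, on which a
contraction-elongation operation yields a simple cubic graph. -/
structure IsFlipConfiguration (G : SimpleGraph V) (f : V → V → V) (v₁ v₂ u₁ u₂ u₃ u₄ : V) :
    Prop where
  adj : G.Adj v₁ v₂
  rot_v₁_v₂ : f v₁ v₂ = u₂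
  rot_v₁_u₂ : f v₁ u₂ = u₁
  rot_v₂_v₁ : f v₂ v₁ = u₃
  rot_v₂_u₃ : f v₂ u₃ = u₄
  ne₁₃ : u₁ ≠ u₃
  ne₂₃ : u₂ ≠ u₃
  ne₂₄ : u₂ ≠ u₄

/-- The permutation of the vertices that takes the neighbours of `a ≠ v₁, v₂` to those after a
contraction-elongation operation. -/
def flipPerm [DecidableEq V] (v₁ v₂ u₂ u₃ a : V) : Equiv.Perm V :=
  if a = u₂ ∨ a = u₃ then Equiv.swap v₁ v₂ else 1

/-- The rotation after a contraction-elongation operation. -/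
def flipRotation [DecidableEq V] (f : V → V → V) (v₁ v₂ u₁ u₂ u₃ u₄ a b : V) : V :=
  if a = v₁ then if b = u₁ then u₃ else if b = u₃ then v₂ else u₁
  else if a = v₂ then if b = v₁ then u₄ else if b = u₄ then u₂ else v₁
  else flipPerm v₁ v₂ u₂ u₃ a (f a (flipPerm v₁ v₂ u₂ u₃ a b))

/-- An edge cut which shows that the contraction-elongation operation on `v₁ v₂` destroys
three-edge-connectedness: afterwards `T \ {v₁}` is left by at most two edges. -/
structure IsObstructingCut (G : SimpleGraph V) (v₁ v₂ u₁ u₂ u₃ u₄ : V) (T : Set V) : Prop where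
  v₁_mem : v₁ ∈ T
  v₂_mem : v₂ ∈ T
  u₂_mem : u₂ ∈ T
  u₄_mem : u₄ ∈ T
  u₁_notMem : u₁ ∉ T
  u₃_notMem : u₃ ∉ T
  cutSize_le : cutSize G T ≤ 3

/-- The labelling of the faces after a contraction-elongation operation, in which a face keeps its
label. Away from the new edge `v₁ v₂`, a dart corresponds to the dart in `G` with the same label. -/
def flipLabelling [DecidableEq V] {X : Type*} (c : V → V → X) (v₁ v₂ u₁ u₂ u₃ u₄ a b : V) : X :=
  if a = v₁ ∧ b = v₂ then c v₂ u₄ else if a = v₂ ∧ b = v₁ then c v₁ u₁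
  else c (flipPerm v₁ v₂ u₂ u₃ b a) (flipPerm v₁ v₂ u₂ u₃ a b)

theorem contractElongate_adj :
    (G.contractElongate v₁ v₂ u₂ u₃).Adj a b ↔
      (G.Adj a b ∧ s(a, b) ≠ s(v₁, u₂) ∧ s(a, b) ≠ s(v₂, u₃)) ∨
        ((s(a, b) = s(v₁, u₃) ∨ s(a, b) = s(v₂, u₂)) ∧ a ≠ b) := by
  simp only [contractElongate, sup_adj, deleteEdges_adj, fromEdgeSet_adj, Set.mem_insert_iff,
    Set.mem_singleton_iff, not_or, ne_eq]

theorem contractElongate_comm :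
    G.contractElongate v₂ v₁ u₃ u₂ = G.contractElongate v₁ v₂ u₂ u₃ := by
  ext a b
  rw [contractElongate_adj, contractElongate_adj]
  tauto

theorem flipPerm_flipPerm [DecidableEq V] :
    flipPerm v₁ v₂ u₂ u₃ a (flipPerm v₁ v₂ u₂ u₃ a b) = b := by
  unfold flipPerm
  split_ifs <;> simp

theorem flipPerm_of_ne [DecidableEq V] (h₁ : b ≠ v₁) (h₂ : b ≠ v₂) :
    flipPerm v₁ v₂ u₂ u₃ a b = b := by
  unfold flipPerm
  split_ifs
  · exact Equiv.swap_apply_of_ne_of_ne h₁ h₂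
  · rfl

theorem flipPerm_mem_iff [DecidableEq V] (hS : v₁ ∈ S ↔ v₂ ∈ S) :
    flipPerm v₁ v₂ u₂ u₃ a b ∈ S ↔ b ∈ S := by
  by_cases h₁ : b = v₁ <;> by_cases h₂ : b = v₂ <;> by_cases ha : a = u₂ ∨ a = u₃ <;>
    simp_all [flipPerm, Equiv.swap_apply_of_ne_of_ne]

namespace IsFlipConfiguration

theorem symm (hF : IsFlipConfiguration G f v₁ v₂ u₁ u₂ u₃ u₄) :
    IsFlipConfiguration G f v₂ v₁ u₄ u₃ u₂ u₁ :=
  ⟨hF.adj.symm, hF.rot_v₂_v₁, hF.rot_v₂_u₃, hF.rot_v₁_v₂, hF.rot_v₁_u₂, hF.ne₂₄.symm,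
    hF.ne₂₃.symm, hF.ne₁₃.symm⟩

variable (hF : IsFlipConfiguration G f v₁ v₂ u₁ u₂ u₃ u₄) (hf : IsCubicRotation G f)
include hf hF

theorem adj_v₁ (w : V) : G.Adj v₁ w ↔ w = v₂ ∨ w = u₂ ∨ w = u₁ := by
  rw [hf.adj_iff hF.adj, hF.rot_v₁_v₂, hF.rot_v₁_u₂]

theorem adj_v₂ (w : V) : G.Adj v₂ w ↔ w = v₁ ∨ w = u₃ ∨ w = u₄ :=
  hF.symm.adj_v₁ hf w

theorem rot_v₁_u₁ : f v₁ u₁ = v₂ := by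
  rw [← hF.rot_v₁_u₂, ← hF.rot_v₁_v₂, hf.cube hF.adj]

theorem v₁_neighbors_ne : u₁ ≠ v₁ ∧ u₁ ≠ v₂ ∧ u₂ ≠ v₁ ∧ u₂ ≠ v₂ ∧ u₁ ≠ u₂ := by
  have adj₁ := (hF.adj_v₁ hf u₁).2 (.inr (.inr rfl))
  have adj₂ := (hF.adj_v₁ hf u₂).2 (.inr (.inl rfl))
  refine ⟨adj₁.ne', ?_, adj₂.ne', ?_, ?_⟩
  · exact hF.rot_v₁_u₁ hf ▸ (hf.ne adj₁).symm
  · exact hF.rot_v₁_v₂ ▸ hf.ne hF.adj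
  · exact hF.rot_v₁_u₂ ▸ hf.ne adj₂

theorem all_ne : v₁ ≠ v₂ ∧ (u₁ ≠ v₁ ∧ u₁ ≠ v₂ ∧ u₂ ≠ v₁ ∧ u₂ ≠ v₂ ∧ u₁ ≠ u₂) ∧
    (u₄ ≠ v₂ ∧ u₄ ≠ v₁ ∧ u₃ ≠ v₂ ∧ u₃ ≠ v₁ ∧ u₄ ≠ u₃) ∧ u₁ ≠ u₃ ∧ u₂ ≠ u₃ ∧ u₂ ≠ u₄ :=
  ⟨hF.adj.ne, hF.v₁_neighbors_ne hf, hF.symm.v₁_neighbors_ne hf, hF.ne₁₃, hF.ne₂₃, hF.ne₂₄⟩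

theorem flipPerm_eq_one [DecidableEq V] (ha : a = v₁ ∨ a = v₂) : flipPerm v₁ v₂ u₂ u₃ a = 1 := by
  have := hF.all_ne hf
  exact if_neg (by grind only)

theorem flipPerm_index [DecidableEq V] :
    flipPerm v₁ v₂ u₂ u₃ (flipPerm v₁ v₂ u₂ u₃ a b) = flipPerm v₁ v₂ u₂ u₃ b := by
  have := hF.all_ne hf
  by_cases h₁ : b = v₁ <;> by_cases h₂ : b = v₂ <;> by_cases ha : a = u₂ ∨ a = u₃ <;>
    simp_all [flipPerm, Equiv.swap_apply_of_ne_of_ne, eq_comm]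

theorem flip_adj_v₁ (w : V) :
    (G.contractElongate v₁ v₂ u₂ u₃).Adj v₁ w ↔ w = u₁ ∨ w = u₃ ∨ w = v₂ := by
  have := hF.all_ne hf
  rw [contractElongate_adj, hF.adj_v₁ hf]
  simp only [ne_eq, Sym2.eq_iff]
  grind only

theorem flip_adj_v₂ (w : V) :
    (G.contractElongate v₁ v₂ u₂ u₃).Adj v₂ w ↔ w = v₁ ∨ w = u₄ ∨ w = u₂ := by
  rw [← contractElongate_comm, hF.symm.flip_adj_v₁ hf]
  tauto

theorem flip_adj [DecidableEq V] (h₁ : a ≠ v₁) (h₂ : a ≠ v₂) :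
    (G.contractElongate v₁ v₂ u₂ u₃).Adj a b ↔ G.Adj a (flipPerm v₁ v₂ u₂ u₃ a b) := by
  have := hF.all_ne hf
  have adj_v₁ := hF.adj_v₁ hf a
  have adj_v₂ := hF.adj_v₂ hf a
  rw [G.adj_comm] at adj_v₁ adj_v₂
  rw [contractElongate_adj]
  simp only [ne_eq, Sym2.eq_iff]
  by_cases hb : b = v₁ ∨ b = v₂
  · unfold flipPerm
    rcases hb with rfl | rfl <;> split_ifs <;>
      simp only [Equiv.swap_apply_left, Equiv.swap_apply_right, Equiv.Perm.one_apply] <;>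
      grind only
  · rw [flipPerm_of_ne (not_or.1 hb).1 (not_or.1 hb).2]
    grind only

theorem flip_adj_flipPerm [DecidableEq V] :
    (G.contractElongate v₁ v₂ u₂ u₃).Adj (flipPerm v₁ v₂ u₂ u₃ b a) (flipPerm v₁ v₂ u₂ u₃ a b) ↔
      G.Adj a b := by
  have := hF.all_ne hf
  by_cases ha : a = v₁ ∨ a = v₂
  · by_cases hb : b = v₁ ∨ b = v₂
    · have flip_v₁ := hF.flip_adj_v₁ hf v₂
      have flip_v₂ := hF.flip_adj_v₂ hf v₁
      have adj_v₁ := hF.adj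
      have adj_v₂ := hF.adj.symm
      rw [hF.flipPerm_eq_one hf ha, hF.flipPerm_eq_one hf hb, Equiv.Perm.one_apply,
        Equiv.Perm.one_apply]
      rcases ha with rfl | rfl <;> rcases hb with rfl | rfl <;> simp_all
    · obtain ⟨hb₁, hb₂⟩ := not_or.1 hb
      rw [flipPerm_of_ne hb₁ hb₂, adj_comm, hF.flip_adj hf hb₁ hb₂, flipPerm_flipPerm, adj_comm]
  · obtain ⟨ha₁, ha₂⟩ := not_or.1 ha
    rw [flipPerm_of_ne ha₁ ha₂, hF.flip_adj hf ha₁ ha₂, flipPerm_flipPerm]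

theorem isCubicRotation [DecidableEq V] :
    IsCubicRotation (G.contractElongate v₁ v₂ u₂ u₃) (flipRotation f v₁ v₂ u₁ u₂ u₃ u₄) := by
  obtain ⟨hv, ⟨-, h₁, h₂, -, -⟩, ⟨-, h₄, h₃, -, -⟩, h₁₃, -, h₂₄⟩ := hF.all_ne hf
  intro a
  by_cases ha₁ : a = v₁
  · subst ha₁
    refine ⟨u₁, u₃, v₂, h₁₃, h₁, h₃, hF.flip_adj_v₁ hf, ?_, ?_, ?_⟩ <;>
      simp [flipRotation, h₁₃.symm, h₁.symm, h₃.symm]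
  by_cases ha₂ : a = v₂
  · subst ha₂
    refine ⟨v₁, u₄, u₂, h₄.symm, h₂.symm, h₂₄.symm, hF.flip_adj_v₂ hf, ?_, ?_, ?_⟩ <;>
      simp [flipRotation, hv.symm, h₄, h₂, h₂₄]
  obtain ⟨p, q, r, hpq, hpr, hqr, hadj, hp, hq, hr⟩ := hf a
  set σ := flipPerm v₁ v₂ u₂ u₃ a with hσ
  have σσ : ∀ b, σ (σ b) = b := fun _ => flipPerm_flipPerm
  have rot_σ : ∀ b, flipRotation f v₁ v₂ u₁ u₂ u₃ u₄ a (σ b) = σ (f a b) := fun b => by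
    rw [flipRotation, if_neg ha₁, if_neg ha₂, ← hσ, σσ]
  have σ_eq_iff : ∀ b c, σ b = c ↔ b = σ c := fun b c =>
    ⟨fun h => by rw [← h, σσ], fun h => by rw [h, σσ]⟩
  refine ⟨σ p, σ q, σ r, σ.injective.ne hpq, σ.injective.ne hpr, σ.injective.ne hqr, fun w => ?_,
    (rot_σ p).trans (congrArg σ hp), (rot_σ q).trans (congrArg σ hq),
    (rot_σ r).trans (congrArg σ hr)⟩
  rw [hF.flip_adj hf ha₁ ha₂, hadj, ← hσ, σ_eq_iff, σ_eq_iff, σ_eq_iff]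

theorem cutSize_flip (hS : v₁ ∈ S ↔ v₂ ∈ S) :
    cutSize (G.contractElongate v₁ v₂ u₂ u₃) S = cutSize G S := by
  classical
  let φ : V × V → V × V := fun p => (flipPerm v₁ v₂ u₂ u₃ p.2 p.1, flipPerm v₁ v₂ u₂ u₃ p.1 p.2)
  have φ_involutive : Function.Involutive φ := fun p => by
    simp only [φ, hF.flipPerm_index hf, flipPerm_flipPerm]
  have image_eq : φ '' edgeBoundary G S = edgeBoundary (G.contractElongate v₁ v₂ u₂ u₃) S := by
    rw [φ_involutive.image_eq_preimage_symm]
    ext p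
    simp only [φ, edgeBoundary, Set.mem_preimage, Set.mem_ofPred_eq, flipPerm_mem_iff hS]
    rw [← hF.flip_adj_flipPerm hf, hF.flipPerm_index hf, hF.flipPerm_index hf, flipPerm_flipPerm,
      flipPerm_flipPerm]
  rw [cutSize, ← image_eq, Set.ncard_image_of_injective _ φ_involutive.injective, cutSize]

theorem notMem_of_cutSize_flip_lt [Finite V] (hG : IsThreeEdgeConnected G) (h₁ : v₁ ∈ S)
    (h₂ : v₂ ∉ S) (hS : cutSize (G.contractElongate v₁ v₂ u₂ u₃) S < 3)
    (ha : (G.contractElongate v₁ v₂ u₂ u₃).Adj v₂ a) (hne : a ≠ v₁) : a ∉ S := by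
  classical
  intro haS
  have cubic := (hF.isCubicRotation hf).isCubic
  have insert_lt := cutSize_insert_lt cubic h₂
    ((hF.flip_adj_v₂ hf v₁).2 (.inl rfl)) h₁ ha haS hne.symm
  rw [hF.cutSize_flip hf (by simp [h₁])] at insert_lt
  by_cases huniv : insert v₂ S = Set.univ
  · have compl_eq : Sᶜ = {v₂} := by
      ext w
      have mem := huniv.symm ▸ Set.mem_univ w
      refine ⟨mem.resolve_right, ?_⟩
      rintro rfl
      exact h₂
    rw [← cutSize_compl, compl_eq, cutSize_singleton cubic] at hS
    exact lt_irrefl 3 hS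
  · exact (hG _ ⟨v₂, Set.mem_insert _ _⟩ huniv).not_gt (insert_lt.trans hS)

theorem exists_isObstructingCut [Finite V] (hG : IsThreeEdgeConnected G) (h₁ : v₁ ∈ S)
    (h₂ : v₂ ∉ S) (hS : cutSize (G.contractElongate v₁ v₂ u₂ u₃) S < 3) :
    IsObstructingCut G v₁ v₂ u₁ u₂ u₃ u₄ (insert v₁ Sᶜ) := by
  classical
  obtain ⟨-, ⟨u₁v₁, u₁v₂, u₂v₁, -, -⟩, ⟨-, u₄v₁, u₃v₂, u₃v₁, -⟩, -⟩ := hF.all_ne hf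
  have v₂_side : ∀ a, _ → a ≠ v₁ → a ∉ S := fun a => hF.notMem_of_cutSize_flip_lt hf hG h₁ h₂ hS
  have v₁_side : ∀ a, (G.contractElongate v₁ v₂ u₂ u₃).Adj v₁ a → a ≠ v₂ → a ∈ S := fun a => by
    rw [← contractElongate_comm] at hS ⊢
    rw [← cutSize_compl] at hS
    intro ha hne
    exact not_not.1 (hF.symm.notMem_of_cutSize_flip_lt hf hG h₂ (not_not.2 h₁) hS ha hne)
  have adj_v₁ := hF.flip_adj_v₁ hf
  have adj_v₂ := hF.flip_adj_v₂ hf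
  refine ⟨.inl rfl, .inr h₂, .inr (v₂_side u₂ ((adj_v₂ _).2 (by simp)) u₂v₁),
    .inr (v₂_side u₄ ((adj_v₂ _).2 (by simp)) u₄v₁), ?_, ?_, ?_⟩
  · exact fun h => h.elim u₁v₁ (absurd (v₁_side u₁ ((adj_v₁ _).2 (by simp)) u₁v₂))
  · exact fun h => h.elim u₃v₁ (absurd (v₁_side u₃ ((adj_v₁ _).2 (by simp)) u₃v₂))
  · rw [← hF.cutSize_flip hf (by simp [h₂])]
    have insert_le := cutSize_insert_le (hF.isCubicRotation hf).isCubic (S := Sᶜ)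
      (not_not.2 h₁) ((adj_v₁ v₂).2 (by simp)) h₂
    rw [cutSize_compl] at insert_le
    omega

theorem isThreeEdgeConnected [Finite V] (hG : IsThreeEdgeConnected G)
    (hT : ∀ T, ¬ IsObstructingCut G v₁ v₂ u₁ u₂ u₃ u₄ T) :
    IsThreeEdgeConnected (G.contractElongate v₁ v₂ u₂ u₃) := by
  intro S hne huniv
  by_contra! hS
  by_cases h₁ : v₁ ∈ S <;> by_cases h₂ : v₂ ∈ S
  · exact (hG S hne huniv).not_gt (hF.cutSize_flip hf (iff_of_true h₁ h₂) ▸ hS)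
  · exact hT _ (hF.exists_isObstructingCut hf hG h₁ h₂ hS)
  · exact hT _ (hF.exists_isObstructingCut hf hG h₁ (not_not.2 h₂) (cutSize_compl S ▸ hS))
  · exact (hG S hne huniv).not_gt (hF.cutSize_flip hf (iff_of_false h₁ h₂) ▸ hS)

theorem faceLabels_subset_flip [DecidableEq V] {X : Type*} {c : V → V → X}
    (hc : IsFaceLabelling G f c) :
    faceLabels G c ⊆
      faceLabels (G.contractElongate v₁ v₂ u₂ u₃) (flipLabelling c v₁ v₂ u₁ u₂ u₃ u₄) := by
  rintro _ ⟨a, b, hab, rfl⟩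
  have ne := hF.all_ne hf
  have next_v₁ := hF.rot_v₂_v₁ ▸ hc v₁ v₂ hF.adj
  have next_v₂ := hF.symm.rot_v₂_v₁ ▸ hc v₂ v₁ hF.adj.symm
  by_cases h₁₂ : a = v₁ ∧ b = v₂
  · refine ⟨v₁, u₃, (hF.flip_adj_v₁ hf _).2 (by simp), ?_⟩
    simp_all [flipLabelling, flipPerm, eq_comm]
  by_cases h₂₁ : a = v₂ ∧ b = v₁
  · refine ⟨v₂, u₂, (hF.flip_adj_v₂ hf _).2 (by simp), ?_⟩
    simp_all [flipLabelling, flipPerm, eq_comm]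
  have eq_of_edge : ∀ v w, (v = v₁ ∨ v = v₂) → (w = v₁ ∨ w = v₂) →
      flipPerm v₁ v₂ u₂ u₃ b a = v → flipPerm v₁ v₂ u₂ u₃ a b = w → a = v ∧ b = w := by
    rintro _ _ hv hw rfl rfl
    have perm_a := hF.flipPerm_eq_one hf hv
    have perm_b := hF.flipPerm_eq_one hf hw
    rw [hF.flipPerm_index hf] at perm_a perm_b
    rw [perm_a, perm_b]
    exact ⟨rfl, rfl⟩
  refine ⟨_, _, (hF.flip_adj_flipPerm hf).2 hab, ?_⟩
  rw [flipLabelling, if_neg fun h => h₁₂ (eq_of_edge _ _ (.inl rfl) (.inr rfl) h.1 h.2),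
    if_neg fun h => h₂₁ (eq_of_edge _ _ (.inr rfl) (.inl rfl) h.1 h.2), hF.flipPerm_index hf,
    hF.flipPerm_index hf, flipPerm_flipPerm, flipPerm_flipPerm]

theorem isFaceLabelling_flip [DecidableEq V] {X : Type*} {c : V → V → X}
    (hc : IsFaceLabelling G f c) :
    IsFaceLabelling (G.contractElongate v₁ v₂ u₂ u₃) (flipRotation f v₁ v₂ u₁ u₂ u₃ u₄)
      (flipLabelling c v₁ v₂ u₁ u₂ u₃ u₄) := by
  have ne := hF.all_ne hf
  have next_u₁ := hc u₁ v₁ ((hF.adj_v₁ hf u₁).2 (by simp)).symm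
  have next_u₂ := hc u₂ v₁ ((hF.adj_v₁ hf u₂).2 (by simp)).symm
  have next_u₃ := hc u₃ v₂ ((hF.adj_v₂ hf u₃).2 (by simp)).symm
  have next_u₄ := hc u₄ v₂ ((hF.adj_v₂ hf u₄).2 (by simp)).symm
  rw [hF.rot_v₁_u₁ hf] at next_u₁
  rw [hF.symm.rot_v₁_u₁ hf] at next_u₄
  rw [hF.rot_v₁_u₂] at next_u₂
  rw [hF.rot_v₂_u₃] at next_u₃
  have next_v₁ := hF.rot_v₂_v₁ ▸ hc v₁ v₂ hF.adj
  have next_v₂ := hF.symm.rot_v₂_v₁ ▸ hc v₂ v₁ hF.adj.symm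
  intro u v huv
  by_cases hv₁ : v = v₁
  · subst hv₁
    rcases (hF.flip_adj_v₁ hf u).1 huv.symm with rfl | rfl | rfl <;>
      simp_all [flipLabelling, flipRotation, flipPerm, eq_comm]
  by_cases hv₂ : v = v₂
  · subst hv₂
    rcases (hF.flip_adj_v₂ hf u).1 huv.symm with rfl | rfl | rfl <;>
      simp_all [flipLabelling, flipRotation, flipPerm, eq_comm]
  have adj := ((hF.flip_adj hf hv₁ hv₂).1 huv.symm).symm
  simp only [flipLabelling, flipRotation, hv₁, hv₂, false_and, and_false, if_false,
    flipPerm_flipPerm, flipPerm_of_ne hv₁ hv₂, hF.flipPerm_index hf]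
  exact hc _ _ adj

end IsFlipConfiguration

theorem IsPlanarCubicMap.flip [Finite V] [Nonempty V] [DecidableEq V] (hf : IsPlanarCubicMap G f)
    (hF : IsFlipConfiguration G f v₁ v₂ u₁ u₂ u₃ u₄)
    (hT : ∀ T, ¬ IsObstructingCut G v₁ v₂ u₁ u₂ u₃ u₄ T) :
    IsPlanarCubicMap (G.contractElongate v₁ v₂ u₂ u₃) (flipRotation f v₁ v₂ u₁ u₂ u₃ u₄) := by
  obtain ⟨c, hc, labels_eq⟩ := hf.rot.exists_faceLabelling
  have flip_rot := hF.isCubicRotation hf.rot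
  refine .of_card_le flip_rot (hF.isThreeEdgeConnected hf.rot hf.conn hT) ?_
  rw [← hf.two_mul_card_face, ← Set.ncard_univ, ← labels_eq]
  have : Finite hf.rot.toRotationSystem.Face := Quotient.finite _
  exact Nat.mul_le_mul_left 2 ((Set.ncard_le_ncard (hF.faceLabels_subset_flip hf.rot hc)).trans
    ((hF.isFaceLabelling_flip hf.rot hc).ncard_faceLabels_le flip_rot))

end Flip

/-! ### ΔY transformation -/

section DeltaY

variable {V : Type u} {G : SimpleGraph V} {f : V → V → V} {a b c x y z : V}

/-- A triangular face `a b c`, with the third neighbours `x`, `y`, `z` of its vertices. -/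
structure IsTriangularFace (G : SimpleGraph V) (f : V → V → V) (a b c x y z : V) : Prop where
  adj_ab : G.Adj a b
  adj_bc : G.Adj b c
  adj_ca : G.Adj c a
  rot_a_c : f a c = b
  rot_b_a : f b a = c
  rot_c_b : f c b = a
  rot_a_b : f a b = x
  rot_b_c : f b c = y
  rot_c_a : f c a = z

/-- The vertices after a ΔY transformation. The triangle `a b c` becomes the vertex `none`. -/
abbrev DeltaYVertex (a b c : V) : Type u :=
  Option {v : V // v ≠ a ∧ v ≠ b ∧ v ≠ c}

/-- The contraction of a triangle to a vertex. -/
def contractTriangle [DecidableEq V] (a b c v : V) : DeltaYVertex a b c :=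
  if h : v ≠ a ∧ v ≠ b ∧ v ≠ c then some ⟨v, h⟩ else none

/-- The neighbour in `G` of a vertex `p` outside the triangle that is contracted to a given
neighbour of `p` after a ΔY transformation. -/
def liftNeighbor [DecidableEq V] (a b c x y p : V) : DeltaYVertex a b c → V
  | some q => q
  | none => if p = x then a else if p = y then b else c

/-- The rotation after a ΔY transformation. -/
def deltaYRotation [DecidableEq V] (f : V → V → V) (a b c x y z : V) :
    DeltaYVertex a b c → DeltaYVertex a b c → DeltaYVertex a b c
  | some p, q => contractTriangle a b c (f p (liftNeighbor a b c x y p q))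
  | none, some q => contractTriangle a b c
      (if (q : V) = x then z else if (q : V) = y then x else y)
  | none, none => none

/-- The labelling of the faces after a ΔY transformation, in which a face other than the triangle
keeps its label. -/
def deltaYLabelling [DecidableEq V] {X : Type*} (l : V → V → X) (a b c x y : V) :
    DeltaYVertex a b c → DeltaYVertex a b c → X
  | some p, q => l p (liftNeighbor a b c x y p q)
  | none, some q => l (liftNeighbor a b c x y q none) q
  | none, none => l a b

section Contract

variable [DecidableEq V]

theorem contractTriangle_coe (p : {v : V // v ≠ a ∧ v ≠ b ∧ v ≠ c}) :
    contractTriangle a b c p = some p :=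
  dif_pos p.2

theorem contractTriangle_eq_none {v : V} :
    contractTriangle a b c v = none ↔ v = a ∨ v = b ∨ v = c := by
  rw [contractTriangle, dite_eq_right_iff]
  simp only [reduceCtorEq, imp_false]
  tauto

theorem contractTriangle_eq_some {v : V} {p : {v : V // v ≠ a ∧ v ≠ b ∧ v ≠ c}} :
    contractTriangle a b c v = some p ↔ v = p := by
  refine ⟨fun h => ?_, fun h => h ▸ contractTriangle_coe p⟩
  unfold contractTriangle at h
  split_ifs at h with hv
  exact congrArg Subtype.val (Option.some_inj.1 h)

theorem contractTriangle_surjective : Function.Surjective (contractTriangle a b c)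
  | none => ⟨a, contractTriangle_eq_none.2 (.inl rfl)⟩
  | some p => ⟨p, contractTriangle_coe p⟩

theorem deltaY_adj_contractTriangle {u v : V} (huv : G.Adj u v)
    (hne : contractTriangle a b c u ≠ contractTriangle a b c v) :
    (G.deltaY a b c).Adj (contractTriangle a b c u) (contractTriangle a b c v) := by
  rcases hu : contractTriangle a b c u with _ | p <;>
    rcases hv : contractTriangle a b c v with _ | q
  · exact absurd (hu.trans hv.symm) hne
  · rw [contractTriangle_eq_some] at hv
    rw [contractTriangle_eq_none] at hu
    subst hv
    rcases hu with rfl | rfl | rfl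
    exacts [.inl huv.symm, .inr (.inl huv.symm), .inr (.inr huv.symm)]
  · rw [contractTriangle_eq_some] at hu
    rw [contractTriangle_eq_none] at hv
    subst hu
    rcases hv with rfl | rfl | rfl
    exacts [.inl huv, .inr (.inl huv), .inr (.inr huv)]
  · rw [contractTriangle_eq_some] at hu hv
    subst hu hv
    exact huv

theorem deltaY_adj_some {p : {v : V // v ≠ a ∧ v ≠ b ∧ v ≠ c}} {q : DeltaYVertex a b c} :
    (G.deltaY a b c).Adj (some p) q ↔ ∃ w, G.Adj p w ∧ contractTriangle a b c w = q := by
  rcases q with _ | q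
  · simp only [contractTriangle_eq_none, and_or_left, exists_or, exists_eq_right]
    rfl
  · simp only [contractTriangle_eq_some, exists_eq_right]
    rfl

end Contract

theorem card_deltaYVertex [Finite V] (hab : a ≠ b) (hbc : b ≠ c) (hca : c ≠ a) :
    Nat.card (DeltaYVertex a b c) + 2 = Nat.card V := by
  have compl_eq : {v : V | v ≠ a ∧ v ≠ b ∧ v ≠ c} = ({a, b, c} : Set V)ᶜ := by
    ext v
    simp only [Set.mem_compl_iff, Set.mem_insert_iff, Set.mem_singleton_iff, not_or,
      Set.mem_ofPred_eq]
  have card_triangle : ({a, b, c} : Set V).ncard = 3 :=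
    Set.ncard_eq_three.2 ⟨a, b, c, hab, hca.symm, hbc, rfl⟩
  have card_compl := Set.ncard_add_ncard_compl ({a, b, c} : Set V)
  have card_coe : Nat.card {v : V // v ≠ a ∧ v ≠ b ∧ v ≠ c} = ({a, b, c} : Set V)ᶜ.ncard :=
    compl_eq ▸ Nat.card_coe_set_eq {v : V | v ≠ a ∧ v ≠ b ∧ v ≠ c}
  rw [Finite.card_option, card_coe]
  omega

namespace IsTriangularFace

theorem rotate (hT : IsTriangularFace G f a b c x y z) : IsTriangularFace G f b c a y z x :=
  ⟨hT.adj_bc, hT.adj_ca, hT.adj_ab, hT.rot_b_a, hT.rot_c_b, hT.rot_a_c, hT.rot_b_c, hT.rot_c_a,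
    hT.rot_a_b⟩

variable (hT : IsTriangularFace G f a b c x y z) (hf : IsCubicRotation G f)
include hT hf

theorem adj_a (w : V) : G.Adj a w ↔ w = c ∨ w = b ∨ w = x := by
  rw [hf.adj_iff hT.adj_ca.symm, hT.rot_a_c, hT.rot_a_b]

theorem rot_a_x : f a x = c := by
  rw [← hT.rot_a_b, ← hT.rot_a_c, hf.cube hT.adj_ca.symm]

theorem x_ne : x ≠ a ∧ x ≠ b ∧ x ≠ c :=
  have adj_ax := (hT.adj_a hf x).2 (.inr (.inr rfl))
  ⟨adj_ax.ne', hT.rot_a_b ▸ hf.ne hT.adj_ab, hT.rot_a_x hf ▸ (hf.ne adj_ax).symm⟩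

theorem third_neighbors_ne [Finite V] (hG : IsThreeEdgeConnected G) (hV : 4 < Nat.card V) :
    x ≠ y := by
  rintro rfl
  have cubic := hf.isCubic
  obtain ⟨x_ne_a, x_ne_b, x_ne_c⟩ := hT.x_ne hf
  have adj_xa := ((hT.adj_a hf x).2 (by simp)).symm
  have adj_xb := ((hT.rotate.adj_a hf x).2 (by simp)).symm
  have cut_a := cutSize_singleton cubic a
  have cut_b := cutSize_insert_le cubic (S := {a}) hT.adj_ab.ne' hT.adj_ab.symm rfl
  have cut_c := cutSize_insert_lt cubic (v := c) (S := {b, a}) (by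
    simp [hT.adj_ca.ne, hT.adj_bc.ne']) hT.adj_ca (by simp) hT.adj_bc.symm (by simp) hT.adj_ab.ne
  have cut_x := cutSize_insert_lt cubic (v := x) (S := {c, b, a}) (by
    simp [x_ne_a, x_ne_b, x_ne_c]) adj_xa (by simp) adj_xb (by simp) hT.adj_ab.ne
  have ne_univ : ({x, c, b, a} : Set V) ≠ Set.univ := fun h => by
    have card_le : ({x, c, b, a} : Set V).ncard ≤ 4 := by
      have h₁ := Set.ncard_insert_le x {c, b, a}
      have h₂ := Set.ncard_insert_le c {b, a}
      have h₃ := Set.ncard_pair hT.adj_ab.ne'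
      omega
    rw [h, Set.ncard_univ] at card_le
    omega
  have := hG _ ⟨x, Set.mem_insert _ _⟩ ne_univ
  omega

theorem label_x_a {X : Type*} {l : V → V → X} (hl : IsFaceLabelling G f l) : l x a = l c z := by
  rw [← hl x a ((hT.adj_a hf x).2 (by simp)).symm, hT.rot_a_x hf, ← hl a c hT.adj_ca.symm,
    hT.rot_c_a]

theorem deltaY_adj_none {p : {v : V // v ≠ a ∧ v ≠ b ∧ v ≠ c}} :
    (G.deltaY a b c).Adj none (some p) ↔ (p : V) = x ∨ (p : V) = z ∨ (p : V) = y := by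
  change (G.Adj p a ∨ G.Adj p b ∨ G.Adj p c) ↔ _
  rw [G.adj_comm p, G.adj_comm p, G.adj_comm p, hT.adj_a hf, hT.rotate.adj_a hf,
    hT.rotate.rotate.adj_a hf]
  have := p.2
  tauto

section Result

variable [DecidableEq V] (hxy : x ≠ y) (hyz : y ≠ z) (hzx : z ≠ x)
include hxy hyz hzx

theorem liftNeighbor_contractTriangle {w : V} {p : {v : V // v ≠ a ∧ v ≠ b ∧ v ≠ c}}
    (hpw : G.Adj p w) : liftNeighbor a b c x y p (contractTriangle a b c w) = w := by
  rcases hw : contractTriangle a b c w with _ | q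
  · obtain ⟨hpa, hpb, hpc⟩ := p.2
    rcases contractTriangle_eq_none.1 hw with rfl | rfl | rfl
    · have p_eq : (p : V) = x := by simpa [hpb, hpc] using (hT.adj_a hf p).1 hpw.symm
      exact if_pos p_eq
    · have p_eq : (p : V) = y := by simpa [hpa, hpc] using (hT.rotate.adj_a hf p).1 hpw.symm
      exact (if_neg (p_eq ▸ hxy.symm)).trans (if_pos p_eq)
    · have p_eq : (p : V) = z := by
        simpa [hpa, hpb] using (hT.rotate.rotate.adj_a hf p).1 hpw.symm
      exact (if_neg (p_eq ▸ hzx)).trans (if_neg (p_eq ▸ hyz.symm))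
  · exact (contractTriangle_eq_some.1 hw).symm

theorem deltaYRotation_some {w : V} {p : {v : V // v ≠ a ∧ v ≠ b ∧ v ≠ c}} (hpw : G.Adj p w) :
    deltaYRotation f a b c x y z (some p) (contractTriangle a b c w) =
      contractTriangle a b c (f p w) :=
  congrArg (fun v => contractTriangle a b c (f p v))
    (hT.liftNeighbor_contractTriangle hf hxy hyz hzx hpw)

theorem isCubicRotation : IsCubicRotation (G.deltaY a b c) (deltaYRotation f a b c x y z) := by
  obtain ⟨y_ne_b, y_ne_c, y_ne_a⟩ := hT.rotate.x_ne hf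
  obtain ⟨z_ne_c, z_ne_a, z_ne_b⟩ := hT.rotate.rotate.x_ne hf
  let x' : {v : V // v ≠ a ∧ v ≠ b ∧ v ≠ c} := ⟨x, hT.x_ne hf⟩
  let y' : {v : V // v ≠ a ∧ v ≠ b ∧ v ≠ c} := ⟨y, y_ne_a, y_ne_b, y_ne_c⟩
  let z' : {v : V // v ≠ a ∧ v ≠ b ∧ v ≠ c} := ⟨z, z_ne_a, z_ne_b, z_ne_c⟩
  rintro (_ | p)
  · refine ⟨some x', some z', some y', by simpa [x', z'] using hzx.symm, by simpa [x', y'],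
      by simpa [y', z'] using hyz.symm, ?_, ?_, ?_, ?_⟩
    · rintro (_ | p)
      · exact iff_of_false id (by simp)
      · simp only [hT.deltaY_adj_none hf, Option.some_inj, Subtype.ext_iff, x', y', z']
    · exact (congrArg _ (if_pos rfl)).trans (contractTriangle_coe z')
    · exact (congrArg _ ((if_neg hzx).trans (if_neg hyz.symm))).trans (contractTriangle_coe y')
    · exact (congrArg _ ((if_neg hxy.symm).trans (if_pos rfl))).trans (contractTriangle_coe x')
  · obtain ⟨q, r, s, hqr, hqs, hrs, hadj, hq, hr, hs⟩ := hf p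
    have lift_eq : ∀ {w}, G.Adj p w → _ := fun hw =>
      hT.liftNeighbor_contractTriangle hf hxy hyz hzx hw
    have contract_ne : ∀ {w w'}, G.Adj p w → G.Adj p w' → w ≠ w' →
        contractTriangle a b c w ≠ contractTriangle a b c w' := fun hw hw' hne h =>
      hne ((lift_eq hw).symm.trans ((congrArg _ h).trans (lift_eq hw')))
    have rot_eq : ∀ {w}, G.Adj p w → _ := fun hw =>
      hT.deltaYRotation_some hf hxy hyz hzx hw
    have adj_q := (hadj q).2 (by simp)
    have adj_r := (hadj r).2 (by simp)
    have adj_s := (hadj s).2 (by simp)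
    refine ⟨_, _, _, contract_ne adj_q adj_r hqr, contract_ne adj_q adj_s hqs,
      contract_ne adj_r adj_s hrs, fun w => ?_, hq ▸ rot_eq adj_q, hr ▸ rot_eq adj_r,
      hs ▸ rot_eq adj_s⟩
    simp only [deltaY_adj_some, hadj, or_and_right, exists_or, exists_eq_left]
    simp only [eq_comm]

theorem injOn_edgeBoundary (S : Set (DeltaYVertex a b c)) :
    Set.InjOn (Prod.map (contractTriangle a b c) (contractTriangle a b c))
      (edgeBoundary G (contractTriangle a b c ⁻¹' S)) := by
  rintro ⟨u, v⟩ ⟨hu, hv, huv : G.Adj u v⟩ ⟨u', v'⟩ ⟨-, -, huv' : G.Adj u' v'⟩ h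
  obtain ⟨hu_eq, hv_eq⟩ := Prod.mk_inj.1 h
  have lift_eq : ∀ {p w}, _ → _ := fun {p w} =>
    hT.liftNeighbor_contractTriangle hf hxy hyz hzx (p := p) (w := w)
  rcases hp : contractTriangle a b c u with _ | p
  · rcases hq : contractTriangle a b c v with _ | q
    · exact absurd (show contractTriangle a b c u ∈ S from hu) (hp ▸ hq ▸ hv)
    · obtain rfl := contractTriangle_eq_some.1 hq
      obtain rfl := contractTriangle_eq_some.1 (hv_eq.symm.trans hq)
      rw [← lift_eq huv.symm, hu_eq, lift_eq huv'.symm]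
  · obtain rfl := contractTriangle_eq_some.1 hp
    obtain rfl := contractTriangle_eq_some.1 (hu_eq.symm.trans hp)
    rw [← lift_eq huv, hv_eq, lift_eq huv']

omit [DecidableEq V] in
theorem isThreeEdgeConnected [Finite V] (hG : IsThreeEdgeConnected G) :
    IsThreeEdgeConnected (G.deltaY a b c) := by
  classical
  intro S hne huniv
  have surjective := contractTriangle_surjective (a := a) (b := b) (c := c)
  refine (hG _ (hne.preimage surjective) fun h => huniv ?_).trans ?_
  · exact Set.preimage_injective.2 surjective (h.trans Set.preimage_univ.symm)
  · refine Set.ncard_le_ncard_of_injOn _ ?_ (hT.injOn_edgeBoundary hf hxy hyz hzx S)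
    rintro ⟨u, v⟩ ⟨hu, hv, huv⟩
    exact ⟨hu, hv, deltaY_adj_contractTriangle huv fun h => hv (Set.mem_preimage.2 (h ▸ hu))⟩

variable {X : Type*} {l : V → V → X}

theorem deltaYLabelling_contractTriangle {u v : V} (huv : G.Adj u v)
    (hne : contractTriangle a b c u ≠ contractTriangle a b c v) :
    deltaYLabelling l a b c x y (contractTriangle a b c u) (contractTriangle a b c v) = l u v := by
  have lift_eq : ∀ {p w}, _ → _ := fun {p w} =>
    hT.liftNeighbor_contractTriangle hf hxy hyz hzx (p := p) (w := w)
  rcases hp : contractTriangle a b c u with _ | p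
  · rcases hq : contractTriangle a b c v with _ | q
    · exact absurd (hp.trans hq.symm) hne
    · obtain rfl := contractTriangle_eq_some.1 hq
      exact congrArg (l · q) (hp ▸ lift_eq huv.symm)
  · obtain rfl := contractTriangle_eq_some.1 hp
    exact congrArg (l p) (lift_eq huv)

theorem isFaceLabelling (hl : IsFaceLabelling G f l) :
    IsFaceLabelling (G.deltaY a b c) (deltaYRotation f a b c x y z)
      (deltaYLabelling l a b c x y) := by
  intro u v huv
  have label_eq : ∀ {u v}, _ → _ → _ := fun {u v} =>
    hT.deltaYLabelling_contractTriangle hf hxy hyz hzx (l := l) (u := u) (v := v)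
  rcases v with _ | v
  · rcases u with _ | u
    · exact huv.elim
    obtain ⟨y_ne_b, y_ne_c, y_ne_a⟩ := hT.rotate.x_ne hf
    obtain ⟨z_ne_c, z_ne_a, z_ne_b⟩ := hT.rotate.rotate.x_ne hf
    have x_eq := contractTriangle_coe ⟨x, hT.x_ne hf⟩
    have y_eq := contractTriangle_coe ⟨y, y_ne_a, y_ne_b, y_ne_c⟩
    have z_eq := contractTriangle_coe ⟨z, z_ne_a, z_ne_b, z_ne_c⟩
    have label_x := hT.label_x_a hf hl
    have label_y := hT.rotate.label_x_a hf hl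
    have label_z := hT.rotate.rotate.label_x_a hf hl
    rcases (hT.deltaY_adj_none hf).1 huv.symm with h | h | h <;>
      simp_all [deltaYRotation, deltaYLabelling, liftNeighbor, eq_comm]
  · obtain ⟨w, hw, rfl⟩ := deltaY_adj_some.1 huv.symm
    rw [hT.deltaYRotation_some hf hxy hyz hzx hw]
    have adj_next := hf.adj hw
    have ne_of_adj : ∀ {w}, G.Adj v w → contractTriangle a b c w ≠ contractTriangle a b c v :=
      fun hw h => hw.ne' (contractTriangle_eq_some.1 (h.trans (contractTriangle_coe v)))
    rw [← contractTriangle_coe v, label_eq adj_next (ne_of_adj adj_next).symm,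
      label_eq hw.symm (ne_of_adj hw), hl w v hw.symm]

theorem faceLabels_subset (hl : IsFaceLabelling G f l) :
    faceLabels G l ⊆
      insert (l a b) (faceLabels (G.deltaY a b c) (deltaYLabelling l a b c x y)) := by
  have mem_of_ne : ∀ {u v}, G.Adj u v → contractTriangle a b c u ≠ contractTriangle a b c v →
      l u v ∈ faceLabels (G.deltaY a b c) (deltaYLabelling l a b c x y) := fun huv hne =>
    ⟨_, _, deltaY_adj_contractTriangle huv hne,
      hT.deltaYLabelling_contractTriangle hf hxy hyz hzx huv hne⟩
  have mem_of_mem : ∀ {u v}, G.Adj u v → (u = a ∨ u = b ∨ u = c) → ¬ (v = a ∨ v = b ∨ v = c) →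
      l u v ∈ faceLabels (G.deltaY a b c) (deltaYLabelling l a b c x y) := fun huv hu hv =>
    mem_of_ne huv fun h => hv (contractTriangle_eq_none.1 (h ▸ contractTriangle_eq_none.2 hu))
  have label_bc : l b c = l a b := hT.rot_b_a ▸ hl a b hT.adj_ab
  have label_ca : l c a = l b c := hT.rot_c_b ▸ hl b c hT.adj_bc
  have label_ba : l a x = l b a := hT.rot_a_b ▸ hl b a hT.adj_ab.symm
  have label_cb : l b y = l c b := hT.rot_b_c ▸ hl c b hT.adj_bc.symm
  have label_ac : l c z = l a c := hT.rot_c_a ▸ hl a c hT.adj_ca.symm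
  have mem_ba := mem_of_mem ((hT.adj_a hf x).2 (by simp)) (by simp) (by simp [hT.x_ne hf])
  have mem_cb := mem_of_mem ((hT.rotate.adj_a hf y).2 (by simp)) (by simp)
    (by simp [hT.rotate.x_ne hf])
  have mem_ac := mem_of_mem ((hT.rotate.rotate.adj_a hf z).2 (by simp)) (by simp)
    (by simp [hT.rotate.rotate.x_ne hf])
  rintro _ ⟨u, v, huv, rfl⟩
  by_cases hne : contractTriangle a b c u = contractTriangle a b c v
  · rcases hu : contractTriangle a b c u with _ | p
    · rcases contractTriangle_eq_none.1 hu with rfl | rfl | rfl <;>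
        rcases contractTriangle_eq_none.1 (hne.symm.trans hu) with rfl | rfl | rfl <;>
        simp_all
    · exact absurd ((contractTriangle_eq_some.1 hu).trans
        (contractTriangle_eq_some.1 (hne.symm.trans hu)).symm) huv.ne
  · exact .inr (mem_of_ne huv hne)

end Result

end IsTriangularFace

theorem IsPlanarCubicMap.deltaY [Finite V] [Nonempty V] [DecidableEq V]
    (hf : IsPlanarCubicMap G f) (hT : IsTriangularFace G f a b c x y z) (hV : 4 < Nat.card V) :
    IsPlanarCubicMap (G.deltaY a b c) (deltaYRotation f a b c x y z) := by
  have hxy := hT.third_neighbors_ne hf.rot hf.conn hV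
  have hyz := hT.rotate.third_neighbors_ne hf.rot hf.conn hV
  have hzx := hT.rotate.rotate.third_neighbors_ne hf.rot hf.conn hV
  obtain ⟨l, hl, labels_eq⟩ := hf.rot.exists_faceLabelling
  have deltaY_rot := hT.isCubicRotation hf.rot hxy hyz hzx
  refine .of_card_le deltaY_rot (hT.isThreeEdgeConnected hf.rot hxy hyz hzx hf.conn) ?_
  change Nat.card (DeltaYVertex a b c) + 4 ≤ _
  have : Finite hf.rot.toRotationSystem.Face := Quotient.finite _
  have card_face_le := (Set.ncard_le_ncard (hT.faceLabels_subset hf.rot hxy hyz hzx hl)).trans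
    (Set.ncard_insert_le _ _)
  rw [labels_eq, Set.ncard_univ] at card_face_le
  have card_labels_le :=
    (hT.isFaceLabelling hf.rot hxy hyz hzx hl).ncard_faceLabels_le deltaY_rot
  have card_vertex := card_deltaYVertex hT.adj_ab.ne hT.adj_bc.ne hT.adj_ca.ne
  have := hf.two_mul_card_face
  omega

end DeltaY

/-! ### Boundary walks of faces -/

section FaceWalk

variable {V : Type u} {G : SimpleGraph V} {f : V → V → V} {x : ℕ → V} {k : ℕ}

/-- A boundary walk of a face, continued periodically. -/
structure IsFaceWalk (G : SimpleGraph V) (f : V → V → V) (x : ℕ → V) : Prop where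
  adj : ∀ i, G.Adj (x i) (x (i + 1))
  step : ∀ i, f (x (i + 1)) (x i) = x (i + 2)

theorem IsCubicRotation.exists_isFaceWalk (hf : IsCubicRotation G f) {u v : V}
    (huv : G.Adj u v) : ∃ x, IsFaceWalk G f x ∧ x 0 = u ∧ x 1 = v := by
  set F := hf.toRotationSystem.faceNext
  let d : ℕ → G.Dart := fun i => (F ^ i) ⟨(u, v), huv⟩
  have d_succ : ∀ i, d (i + 1) = F (d i) := fun i => by
    simp only [d, pow_succ', Equiv.Perm.mul_apply]
  have fst_succ : ∀ i, (d (i + 1)).fst = (d i).snd := fun i => by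
    rw [d_succ]
    rfl
  refine ⟨fun i => (d i).fst, ⟨fun i => ?_, fun i => ?_⟩, rfl, rfl⟩
  · rw [fst_succ]
    exact (d i).adj
  · rw [fst_succ, fst_succ, d_succ]
    rfl

namespace IsFaceWalk

/-- The `i`-th edge of a boundary walk, directed along the walk. -/
def dart (hx : IsFaceWalk G f x) (i : ℕ) : G.Dart :=
  ⟨(x i, x (i + 1)), hx.adj i⟩

theorem dart_eq_iff (hx : IsFaceWalk G f x) {i j : ℕ} :
    hx.dart i = hx.dart j ↔ x i = x j ∧ x (i + 1) = x (j + 1) :=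
  ⟨fun h => Prod.mk_inj.1 (congrArg Dart.toProd h), fun h => Dart.ext _ _ (Prod.ext h.1 h.2)⟩

theorem shift (hx : IsFaceWalk G f x) (n : ℕ) : IsFaceWalk G f fun i => x (i + n) where
  adj i := by
    rw [add_right_comm]
    exact hx.adj (i + n)
  step i := by
    rw [add_right_comm i 1, add_right_comm i 2]
    exact hx.step (i + n)

section CubicRotation

variable (hx : IsFaceWalk G f x) (hf : IsCubicRotation G f)
include hx hf

theorem faceNext_pow_dart (i n : ℕ) :
    (hf.toRotationSystem.faceNext ^ n) (hx.dart i) = hx.dart (i + n) := by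
  induction n with
  | zero => rfl
  | succ n ih =>
    rw [pow_succ', Equiv.Perm.mul_apply, ih]
    exact Dart.ext _ _ (Prod.ext rfl (hx.step (i + n)))

theorem dart_add_eq_iff {i j : ℕ} (n : ℕ) :
    hx.dart (i + n) = hx.dart (j + n) ↔ hx.dart i = hx.dart j := by
  rw [← hx.faceNext_pow_dart hf, ← hx.faceNext_pow_dart hf,
    (hf.toRotationSystem.faceNext ^ n).injective.eq_iff]

theorem periodic_of_dart_eq {i : ℕ} (h : hx.dart (i + k) = hx.dart i) : Function.Periodic x k := by
  intro j
  rw [← zero_add i, add_right_comm, hx.dart_add_eq_iff hf, ← hx.dart_add_eq_iff hf j,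
    add_right_comm, zero_add] at h
  exact (hx.dart_eq_iff.1 h).1

theorem exists_periodic [Finite V] : ∃ k, 0 < k ∧ Function.Periodic x k := by
  classical
  refine ⟨_, orderOf_pos hf.toRotationSystem.faceNext, hx.periodic_of_dart_eq hf (i := 0) ?_⟩
  rw [← hx.faceNext_pow_dart hf, pow_orderOf_eq_one, Equiv.Perm.one_apply]

theorem rot_rot (i : ℕ) : f (x (i + 1)) (f (x (i + 1)) (x (i + 2))) = x i := by
  rw [← hx.step i, hf.cube (hx.adj i).symm]

theorem adj_iff (i : ℕ) (w : V) :
    G.Adj (x (i + 1)) w ↔ w = x i ∨ w = x (i + 2) ∨ w = f (x (i + 1)) (x (i + 2)) := by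
  rw [hf.adj_iff (hx.adj i).symm, hx.step]

theorem ne_add_two (i : ℕ) : x i ≠ x (i + 2) :=
  hx.step i ▸ (hf.ne (hx.adj i).symm).symm

end CubicRotation

section PlanarCubicMap

variable [Finite V] (hx : IsFaceWalk G f x) (hf : IsPlanarCubicMap G f)
include hx hf

theorem dart_ne_symm (i j : ℕ) : hx.dart j ≠ (hx.dart i).symm := by
  intro h
  set F := hf.rot.toRotationSystem.faceNext
  have sameCycle : ∀ n, F.SameCycle (hx.dart 0) (hx.dart n) := fun n =>
    ⟨n, by rw [zpow_natCast, hx.faceNext_pow_dart hf.rot, zero_add]⟩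
  have : Nonempty V := ⟨x 0⟩
  obtain ⟨S, hS⟩ := exists_cutSize_eq_one_of_sameCycle_symm hf.planar
    (connected_of_isThreeEdgeConnected hf.conn) hf.rot.exists_adj
    (h ▸ (sameCycle i).symm.trans (sameCycle j))
  refine absurd (hf.conn S (Set.nonempty_iff_ne_empty.2 ?_) ?_) (by omega)
  · rintro rfl
    simp [cutSize, edgeBoundary] at hS
  · rintro rfl
    simp [cutSize, edgeBoundary] at hS

theorem eq_of_succ_eq {i j : ℕ} (h : x (i + 1) = x (j + 1)) : x i = x j := by
  rcases (hx.adj_iff hf.rot j (x i)).1 (h ▸ (hx.adj i).symm) with h' | h' | h'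
  · exact h'
  · exact absurd (Dart.ext _ _ (Prod.ext h' h)) (hx.dart_ne_symm hf (j + 1) i)
  · have step := hx.step i
    rw [h', h, ← hx.step j, hf.rot.cube (hx.adj j).symm] at step
    exact absurd (Dart.ext _ _ (Prod.ext h step.symm)) (hx.dart_ne_symm hf j (i + 1))

theorem ne_of_lt (hper : Function.Periodic x k)
    (hmin : ∀ i j, i < j → j < i + k → hx.dart j ≠ hx.dart i) {i j : ℕ} (hij : i < j)
    (hjk : j < i + k) : x i ≠ x j := by
  intro h
  obtain ⟨m, rfl⟩ : ∃ m, k = m + 1 := ⟨k - 1, by omega⟩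
  have succ_eq : x (j + m + 1) = x (i + m + 1) := (hper j).trans (h.symm.trans (hper i).symm)
  exact hmin (i + m) (j + m) (by omega) (by omega)
    (hx.dart_eq_iff.2 ⟨hx.eq_of_succ_eq hf succ_eq, succ_eq⟩)

theorem rot_ne (h₁₄ : x 1 ≠ x 4) : f (x 1) (x 2) ≠ x 3 := by
  intro h
  have adj₃₁ : G.Adj (x 3) (x 1) := h ▸ (hf.rot.adj (hx.adj 1)).symm
  have rot₃₁ : f (x 3) (x 1) = x 2 := by
    rcases (hx.adj_iff hf.rot 2 (x 1)).1 adj₃₁ with h' | h' | h'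
    · exact absurd h' (hx.adj 1).ne
    · exact absurd h' h₁₄
    · rw [h', hx.rot_rot hf.rot 2]
  -- The boundary walk of the face on the other side traverses an edge in both directions.
  have adj₂ := hf.rot.adj (hx.adj 2)
  obtain ⟨y, hy, hy₀, hy₁⟩ := hf.rot.exists_isFaceWalk adj₂.symm
  have hy₂ : y 2 = x 1 := by rw [← hy.step 0, hy₁, hy₀, hx.rot_rot hf.rot 1]
  have hy₃ : y 3 = x 3 := by rw [← hy.step 1, hy₂, hy₁, h]
  have hy₄ : y 4 = x 2 := by rw [← hy.step 2, hy₃, hy₂, rot₃₁]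
  have hy₅ : y 5 = y 0 := by rw [← hy.step 3, hy₄, hy₃, hy₀]
  exact hy.dart_ne_symm hf 0 4 (Dart.ext _ _ (Prod.ext (hy₄.trans hy₁.symm) hy₅))

omit hf in
theorem not_isObstructingCut_succ (hf : IsCubicRotation G f) (hG : IsThreeEdgeConnected G)
    (h₀₃ : x 0 ≠ x 3) {T T' : Set V}
    (hT : IsObstructingCut G (x 1) (x 2) (x 0) (f (x 1) (x 2)) (x 3) (f (x 2) (x 3)) T) :
    ¬ IsObstructingCut G (x 2) (x 3) (x 1) (f (x 2) (x 3)) (x 4) (f (x 3) (x 4)) T' := by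
  intro hT'
  have x₄_notMem : x 4 ∉ T := fun x₄_mem => by
    have insert_lt := cutSize_insert_lt hf.isCubic hT.u₃_notMem (hx.adj 2).symm hT.v₂_mem
      (hx.adj 3) x₄_mem (hx.ne_add_two hf 2)
    have := hG (insert (x 3) T) ⟨_, Set.mem_insert _ _⟩
      ((Set.ne_univ_iff_exists_notMem _).2 ⟨x 0, not_or.2 ⟨h₀₃, hT.u₁_notMem⟩⟩)
    have := hT.cutSize_le
    omega
  have union_le : 3 ≤ cutSize G (T ∪ T') := hG _ ⟨_, .inl hT.v₁_mem⟩
    ((Set.ne_univ_iff_exists_notMem _).2 ⟨x 4, not_or.2 ⟨x₄_notMem, hT'.u₃_notMem⟩⟩)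
  have adj_u₄ : G.Adj (x 2) (f (x 2) (x 3)) := hf.adj (hx.adj 2)
  have insert_lt := cutSize_insert_lt hf.isCubic (S := (T ∩ T')ᶜ)
    (not_not.2 ⟨hT.v₂_mem, hT'.v₁_mem⟩) (hx.adj 1).symm (fun h => hT'.u₁_notMem h.2) (hx.adj 2)
    (fun h => hT.u₃_notMem h.1) (hx.ne_add_two hf 1)
  have insert_le := hG (insert (x 2) (T ∩ T')ᶜ) ⟨_, Set.mem_insert _ _⟩
    ((Set.ne_univ_iff_exists_notMem _).2 ⟨_, not_or.2
      ⟨adj_u₄.ne', not_not.2 ⟨hT.u₄_mem, hT'.u₂_mem⟩⟩⟩)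
  rw [cutSize_compl] at insert_lt
  have := cutSize_inter_add_cutSize_union_le (G := G) T T'
  have := hT.cutSize_le
  have := hT'.cutSize_le
  omega

theorem rot_ne_rot (hT : ∀ T, ¬ IsObstructingCut G (x 1) (x 2) (x 0) (f (x 1) (x 2)) (x 3)
    (f (x 2) (x 3)) T) : f (x 1) (x 2) ≠ f (x 2) (x 3) := by
  intro h
  have adj₁ := hf.rot.adj (hx.adj 1)
  have adj₂ := h ▸ hf.rot.adj (hx.adj 2)
  have rot₁ := hx.rot_rot hf.rot 0
  have ne₃ := hf.rot.ne (hx.adj 2)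
  rw [← h] at ne₃ hT
  set w := f (x 1) (x 2)
  have ne₀ : x 0 ≠ w := rot₁ ▸ hf.rot.ne adj₁
  have cubic := hf.rot.isCubic
  have cut₁ := cutSize_singleton cubic (x 1)
  have cut₂ := cutSize_insert_le cubic (v := x 2) (S := {x 1}) (hx.adj 1).ne' (hx.adj 1).symm rfl
  have cut_w := cutSize_insert_lt cubic (v := w) (S := {x 2, x 1}) (by simp [adj₁.ne', adj₂.ne'])
    adj₁.symm (by simp) adj₂.symm (by simp) (hx.adj 1).ne
  refine hT {w, x 2, x 1} ⟨by simp, by simp, by simp, by simp, ?_, ?_, by omega⟩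
  · simp [ne₀, (hx.adj 0).ne, hx.ne_add_two hf.rot 0]
  · simp [ne₃.symm, (hx.adj 2).ne', (hx.ne_add_two hf.rot 1).symm]

theorem isFlipConfiguration (h₀₃ : x 0 ≠ x 3) (h₁₄ : x 1 ≠ x 4)
    (hT : ∀ T, ¬ IsObstructingCut G (x 1) (x 2) (x 0) (f (x 1) (x 2)) (x 3) (f (x 2) (x 3)) T) :
    IsFlipConfiguration G f (x 1) (x 2) (x 0) (f (x 1) (x 2)) (x 3) (f (x 2) (x 3)) :=
  ⟨hx.adj 1, rfl, hx.rot_rot hf.rot 0, hx.step 1, rfl, h₀₃, hx.rot_ne hf h₁₄, hx.rot_ne_rot hf hT⟩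

end PlanarCubicMap

end IsFaceWalk

end FaceWalk

/-! ### Reduction to the complete graph on four vertices -/

section Reduction

variable {V : Type u} {G : SimpleGraph V} {f : V → V → V} {x : ℕ → V} {k : ℕ}

theorem flipRotation_of_ne [DecidableEq V] {v₁ v₂ u₁ u₂ u₃ u₄ a b : V} (ha₁ : a ≠ v₁)
    (ha₂ : a ≠ v₂) (hb₁ : b ≠ v₁) (hb₂ : b ≠ v₂)
    (h : f a b ≠ v₁ ∧ f a b ≠ v₂ ∨ a ≠ u₂ ∧ a ≠ u₃) :
    flipRotation f v₁ v₂ u₁ u₂ u₃ u₄ a b = f a b := by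
  rw [flipRotation, if_neg ha₁, if_neg ha₂, flipPerm_of_ne hb₁ hb₂]
  rcases h with ⟨h₁, h₂⟩ | ⟨h₂, h₃⟩
  · exact flipPerm_of_ne h₁ h₂
  · rw [flipPerm, if_neg (not_or.2 ⟨h₂, h₃⟩), Equiv.Perm.one_apply]

namespace IsFaceWalk

theorem exists_shorter [DecidableEq V] (hx : IsFaceWalk G f x) (hf : IsCubicRotation G f)
    (hk : 4 ≤ k) (hper : Function.Periodic x k) (hne : ∀ i j, i < j → j < i + k → x i ≠ x j)
    {u₂ u₄ : V} (hF : IsFlipConfiguration G f (x 1) (x 2) (x 0) u₂ (x 3) u₄) :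
    ∃ y, IsFaceWalk (G.contractElongate (x 1) (x 2) u₂ (x 3))
      (flipRotation f (x 1) (x 2) (x 0) u₂ (x 3) u₄) y ∧ Function.Periodic y (k - 1) := by
  obtain ⟨m, rfl⟩ : ∃ m, k = m + 4 := ⟨k - 4, by omega⟩
  have ne₁ : ∀ i, i ≤ m + 1 → x (i + 3) ≠ x 1 := fun i hi =>
    (hne 1 (i + 3) (by omega) (by omega)).symm
  have ne₂ : ∀ i, i ≤ m + 2 → x (i + 3) ≠ x 2 := fun i hi =>
    (hne 2 (i + 3) (by omega) (by omega)).symm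
  have flip_rot := hF.isCubicRotation hf
  obtain ⟨y, hy, y₀, y₁⟩ := flip_rot.exists_isFaceWalk ((hF.flip_adj_v₁ hf (x 3)).2 (by simp))
  have y₂ : y 2 = x 4 := by
    have rot₃ : f (x 3) (x 2) = x 4 := hx.step 2
    rw [← hy.step 0, y₁, y₀, flipRotation, if_neg (ne₁ 0 (by omega)), if_neg (ne₂ 0 (by omega)),
      flipPerm, if_pos (.inr rfl), Equiv.swap_apply_left, rot₃,
      Equiv.swap_apply_of_ne_of_ne (ne₁ 1 (by omega)) (ne₂ 1 (by omega))]
  -- The new walk is `x 1, x 3, x 4, …, x k = x 0`, bypassing `x 2`.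
  have y_eq : ∀ i ≤ m, y (i + 1) = x (i + 3) ∧ y (i + 2) = x (i + 4) := fun i hi => by
    induction i with
    | zero => exact ⟨y₁, y₂⟩
    | succ i ih =>
      obtain ⟨y_succ, y_add_two⟩ := ih (by omega)
      have step := hx.step (i + 3)
      refine ⟨y_add_two, ?_⟩
      rw [← hy.step (i + 1), y_add_two, y_succ, flipRotation_of_ne (ne₁ _ (by omega))
        (ne₂ _ (by omega)) (ne₁ _ (by omega)) (ne₂ _ (by omega)), step]
      exact .inl (step ▸ ⟨ne₁ (i + 2) (by omega), ne₂ (i + 2) (by omega)⟩)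
  obtain ⟨y_last, y_end⟩ := y_eq m le_rfl
  have x_end : x (m + 4) = x 0 := by simpa using hper 0
  have y_period : y (m + 3) = x 1 := by
    have := hF.all_ne hf
    rw [← hy.step (m + 1), y_end, y_last, x_end, flipRotation_of_ne (by grind only)
      (by grind only) (ne₁ _ (by omega)) (ne₂ _ (by omega)) (.inr (by grind only)), ← x_end]
    exact (hx.step (m + 3)).trans ((congrArg x (by omega)).trans (hper 1))
  have y_period_succ : y (m + 4) = x 3 := by
    rw [← hy.step (m + 2), y_period, y_end, x_end, flipRotation, if_pos rfl, if_pos rfl]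
  refine ⟨y, hy, hy.periodic_of_dart_eq flip_rot (i := 0) (hy.dart_eq_iff.2 ?_)⟩
  simp only [Nat.add_succ_sub_one, zero_add, y₀, y₁]
  exact ⟨y_period, y_period_succ⟩

theorem isTriangularFace (hx : IsFaceWalk G f x) (hper : Function.Periodic x 3) :
    IsTriangularFace G f (x 0) (x 1) (x 2) (f (x 0) (x 1)) (f (x 1) (x 2)) (f (x 2) (x 0)) where
  adj_ab := hx.adj 0
  adj_bc := hx.adj 1
  adj_ca := hper 0 ▸ hx.adj 2
  rot_a_c := by rw [← hper 0, ← hper 1, ← hx.step 2]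
  rot_b_a := hx.step 0
  rot_c_b := by rw [← hper 0, ← hx.step 1]
  rot_a_b := rfl
  rot_b_c := rfl
  rot_c_a := rfl

end IsFaceWalk

/-- The graph `G` can be transformed into `K₄` by ΔY and contraction-elongation operations on
three-connected planar cubic graphs. -/
def IsReducible (G : SimpleGraph V) : Prop :=
  ∃ (n : ℕ) (W : ℕ → Type u) (H : ∀ i, SimpleGraph (W i)),
    Nonempty (H 0 ≃g G) ∧
    Nonempty (H n ≃g (⊤ : SimpleGraph (Fin 4))) ∧
    (∀ i ≤ n, Finite (W i) ∧ (H i).IsCubic ∧ (H i).IsThreeConnected ∧ (H i).IsPlanar) ∧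
    (∀ i < n, (H i).IsDeltaY (H (i + 1)) ∨ (H i).IsContractionElongation (H (i + 1)))

namespace IsPlanarCubicMap

variable [Finite V]

theorem isReducible_of_step [Nonempty V] (hf : IsPlanarCubicMap G f) {V' : Type u}
    {G' : SimpleGraph V'} (h : IsReducible G')
    (hstep : ∀ {W : Type u} (K : SimpleGraph W), Nonempty (K ≃g G') →
      G.IsDeltaY K ∨ G.IsContractionElongation K) : IsReducible G := by
  obtain ⟨n, W, H, start, finish, valid, steps⟩ := h
  let W' : ℕ → Type u := fun i => Nat.casesOn i V W
  let H' : ∀ i, SimpleGraph (W' i) := fun i =>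
    Nat.casesOn (motive := fun i => SimpleGraph (W' i)) i G H
  refine ⟨n + 1, W', H', ⟨Iso.refl⟩, finish, ?_, ?_⟩
  · rintro (_ | i) hi
    · exact ⟨‹_›, hf.rot.isCubic, hf.isThreeConnected, hf.rot.toRotationSystem, hf.planar⟩
    · exact valid i (by omega)
  · rintro (_ | i) hi
    · exact hstep _ start
    · exact steps i (by omega)

theorem isReducible_of_card_eq_four [Nonempty V] (hf : IsPlanarCubicMap G f)
    (hV : Nat.card V = 4) : IsReducible G := by
  have neighborSet_eq : ∀ v, G.neighborSet v = {v}ᶜ := fun v => by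
    refine Set.eq_of_subset_of_ncard_le (fun w hw => hw.ne') ?_
    rw [hf.rot.isCubic v, Set.ncard_compl, Set.ncard_singleton, hV]
  have adj_iff : ∀ v w, G.Adj v w ↔ v ≠ w := fun v w => by
    rw [← mem_neighborSet, neighborSet_eq, Set.mem_compl_singleton_iff, ne_comm]
  refine ⟨0, fun _ => V, fun _ => G, ⟨Iso.refl⟩, ⟨⟨Finite.equivFinOfCardEq hV, ?_⟩⟩, fun _ _ =>
    ⟨‹_›, hf.rot.isCubic, hf.isThreeConnected, hf.rot.toRotationSystem, hf.planar⟩, by simp⟩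
  simp [adj_iff]

theorem isReducible_of_flip [Nonempty V] (hf : IsPlanarCubicMap G f) {v₁ v₂ u₁ u₂ u₃ u₄ : V}
    (hF : IsFlipConfiguration G f v₁ v₂ u₁ u₂ u₃ u₄)
    (h : IsReducible (G.contractElongate v₁ v₂ u₂ u₃)) : IsReducible G := by
  refine hf.isReducible_of_step h fun K hK => .inr ⟨hf.rot.toRotationSystem, hf.planar, v₁, v₂,
    u₁, u₂, u₃, u₄, ?_, ?_, ?_, ?_, hK⟩
  · exact hF.rot_v₁_u₁ hf.rot ▸ hf.rot.consecutive ((hF.adj_v₁ hf.rot u₁).2 (by simp)).symm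
  · exact hF.rot_v₂_v₁ ▸ hf.rot.consecutive hF.adj
  · exact hF.symm.rot_v₁_u₁ hf.rot ▸
      hf.rot.consecutive ((hF.adj_v₂ hf.rot u₄).2 (by simp)).symm
  · exact hF.rot_v₁_v₂ ▸ hf.rot.consecutive hF.adj.symm

theorem isReducible_of_deltaY [Nonempty V] (hf : IsPlanarCubicMap G f) {a b c u v w : V}
    (hT : IsTriangularFace G f a b c u v w) (h : IsReducible (G.deltaY a b c)) :
    IsReducible G := by
  refine hf.isReducible_of_step h fun K hK =>
    .inl ⟨hf.rot.toRotationSystem, hf.planar, a, b, c, ?_, ?_, ?_, hK⟩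
  · exact hT.rot_b_a ▸ hf.rot.consecutive hT.adj_ab
  · exact hT.rot_c_b ▸ hf.rot.consecutive hT.adj_bc
  · exact hT.rot_a_c ▸ hf.rot.consecutive hT.adj_ca

theorem isReducible_of_periodic
    (triangle : ∀ {G : SimpleGraph V} {f : V → V → V} {a b c u v w : V}, IsPlanarCubicMap G f →
      IsTriangularFace G f a b c u v w → IsReducible G)
    (hf : IsPlanarCubicMap G f) (hx : IsFaceWalk G f x) (hk : 0 < k)
    (hper : Function.Periodic x k) : IsReducible G := by
  classical
  induction k using Nat.strong_induction_on generalizing G f x with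
  | _ k ih =>
  by_cases hmin : ∀ i j, i < j → j < i + k → hx.dart j ≠ hx.dart i
  swap
  · push Not at hmin
    obtain ⟨i, j, hij, hjk, h⟩ := hmin
    obtain ⟨l, rfl⟩ := Nat.exists_eq_add_of_lt hij
    exact ih (l + 1) (by omega) hf hx (by omega) (hx.periodic_of_dart_eq hf.rot h)
  have x_ne : ∀ i j, i < j → j < i + k → x i ≠ x j := fun i j => hx.ne_of_lt hf hper hmin
  rcases (show k = 1 ∨ k = 2 ∨ k = 3 ∨ 4 ≤ k by omega) with rfl | rfl | rfl | hk₄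
  · exact absurd (hper 0).symm (hx.adj 0).ne
  · exact absurd (hper 0).symm (hx.ne_add_two hf.rot 0)
  · exact triangle hf (hx.isTriangularFace hper)
  have flip : ∀ {x : ℕ → V}, IsFaceWalk G f x → Function.Periodic x k →
      (∀ i j, i < j → j < i + k → x i ≠ x j) →
      (∀ T, ¬ IsObstructingCut G (x 1) (x 2) (x 0) (f (x 1) (x 2)) (x 3) (f (x 2) (x 3)) T) →
      IsReducible G := fun {x} hx hper x_ne hT => by
    have : Nonempty V := ⟨x 0⟩
    have hF := hx.isFlipConfiguration hf (x_ne 0 3 (by omega) (by omega))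
      (x_ne 1 4 (by omega) (by omega)) hT
    obtain ⟨y, hy, hy_per⟩ := hx.exists_shorter hf.rot hk₄ hper x_ne hF
    exact hf.isReducible_of_flip hF (ih (k - 1) (by omega) (hf.flip hF hT) hy (by omega) hy_per)
  by_cases hT : ∃ T, IsObstructingCut G (x 1) (x 2) (x 0) (f (x 1) (x 2)) (x 3) (f (x 2) (x 3)) T
  · obtain ⟨T, hT⟩ := hT
    refine flip (hx.shift 1) (fun i => ?_) (fun i j _ _ => x_ne _ _ (by omega) (by omega))
      fun _ => hx.not_isObstructingCut_succ hf.rot hf.conn (x_ne 0 3 (by omega) (by omega)) hT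
    rw [add_right_comm, hper]
  · exact flip hx hper x_ne (not_exists.1 hT)

theorem isReducible [Nonempty V] (hf : IsPlanarCubicMap G f) : IsReducible G := by
  classical
  induction hV : Nat.card V using Nat.strong_induction_on generalizing V with
  | _ N ih =>
  subst hV
  have four_le : 4 ≤ Nat.card V := card_gt_three hf.rot.isCubic
  rcases four_le.eq_or_lt with hV | hV
  · exact hf.isReducible_of_card_eq_four hV.symm
  obtain ⟨v⟩ := ‹Nonempty V›
  obtain ⟨w, hvw⟩ := hf.rot.exists_adj v
  obtain ⟨x, hx, -, -⟩ := hf.rot.exists_isFaceWalk hvw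
  obtain ⟨k, hk, hper⟩ := hx.exists_periodic hf.rot
  refine isReducible_of_periodic (fun hf hT => ?_) hf hx hk hper
  have card_eq := card_deltaYVertex hT.adj_ab.ne hT.adj_bc.ne hT.adj_ca.ne
  exact hf.isReducible_of_deltaY hT
    (ih (Nat.card (DeltaYVertex _ _ _)) (by omega) (hf.deltaY hT hV) rfl)

end IsPlanarCubicMap

end Reduction

end CubicMap

theorem lemma3p11 {V : Type u} [Finite V] (G : SimpleGraph V)
    (hreg : G.IsCubic) (hconn : G.IsThreeConnected) (hplanar : G.IsPlanar) :
    ∃ (n : ℕ) (W : ℕ → Type u) (H : ∀ i, SimpleGraph (W i)),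
      Nonempty (H 0 ≃g G) ∧
      Nonempty (H n ≃g (⊤ : SimpleGraph (Fin 4))) ∧
      (∀ i ≤ n, Finite (W i) ∧ (H i).IsCubic ∧ (H i).IsThreeConnected ∧ (H i).IsPlanar) ∧
      (∀ i < n, (H i).IsDeltaY (H (i + 1)) ∨ (H i).IsContractionElongation (H (i + 1))) := by
  have : Nonempty V := (Nat.card_pos_iff.1 (Nat.zero_lt_of_lt hconn.1)).1
  obtain ⟨f, hf⟩ := CubicMap.exists_isPlanarCubicMap hreg hconn hplanar
  exact hf.isReducible
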